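/- Let $\Gamma\subset SL(2,\mathbb C)$ be a finite group with irreducible representations $\rho_0,\dots,\rho_r$ ($\rho_0$ trivial), let $Q_0=\{0,\dots,r\}$, and let $Q$ be the doubled McKay quiver, with $a_{ij}=\dim\operatorname{Hom}_\Gamma(\rho_j,\rho_i\otimes\mathbb C^2)$ arrows between $i$ and $j$ in each direction. For $\mathbf w\in\mathbb Z_{\ge0}^{Q_0}$ let $\Pi^{\mathbf w}$ be the preprojective algebra of the framed McKay graph, obtained by adding a vertex $\infty$ joined to each $i$ by $\mathbf w_i$ edges. For $I\subset Q_0$ and $\mathbf v\in\mathbb Z_{\ge0}^{Q_0}$ let $\theta_I$ be the stability parameter with $\theta_I(e_i)=1$ for $i\in I$, $\theta_I(e_i)=0$ for $i\in Q_0\setminus I$, and $\theta_I(e_\infty)=-\sum_{i\in I}\mathbf v_i$; a module $M$ is $\theta$-semistable if $\theta(\dim M)=0$ and $\theta(\dim N)\ge0$ for all submodules $N$, and $\theta$-stable if moreover $M\ne0$ and $\theta(\dim N)>0$ for all proper nonzero $N$. A $\Pi_0$-module is a $Q_0$-graded vector space and a $\Pi_{I,0}$-module is an $I$-graded one. For finite-dimensional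 $\Pi_0$-modules $U,W$ with $\mathbf v=\dim U$, $\mathbf w=\dim W$, the points of the Nakajima quiver variety $\mathfrak M_{\theta_I}(U,W)(\mathbb C)$ are the $S_{\theta_I}$-equivalence classes $[M]$ of $\theta_I$-semistable $\Pi^{\mathbf w}$-modules $M$ of dimension vector $(1,\dim U)$, where two such modules are $S_\theta$-equivalent if they have finite filtrations by submodules on whose dimension vectors $\theta$ vanishes, with isomorphic associated graded modules. Call $U$ *sufficient with respect to $I$* if $2\dim U_i\ge\sum_{j}a_{ij}\dim U_j$ for every $i\notin I$. Write $S_i$ for the vertex simple module at $i$. **Lemma.** Let $I\subset Q_0$ be nonempty, let $V$ be a finite-dimensional $\Pi_{I,0}$-module, and let $U,U',W$ be finite-dimensional $\Pi_0$-modules with $U|_I\cong U'|_I\cong V$, $\dim U\le\dim U'$, and $U'$ sufficient with respect to $I$. Then there is an injective map of sets $$f\colon\mathfrak M_{\theta_I}(U,W)(\mathbb C)\hookrightarrow\mathfrak M_{\theta_I}(U',W)(\mathbb C),\qquad [M]\mapsto\Big[M\oplus\bigoplus_{i\notin I}S_i^{\dim U'_i-\dim U_i}\Big].$$ If $M\cong\bigoplus_\alpha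 M_\alpha$ is a finite direct sum of $\theta_I$-stable modules and $M_a$ is the summand with $\dim e_\infty M_a=1$, then $\dim e_iM_a\le\dim U'_i$ for all $i\in Q_0$ and $f([M])=\big[M_a\oplus\bigoplus_{i\notin I}S_i^{\dim U'_i-\dim e_iM_a}\big]$. If $U$ is also sufficient with respect to $I$, and $W_i=0$ for all $i\notin I$, then $f$ is a bijection. -/

import Mathlib

open scoped BigOperators

namespace McKayNQV

noncomputable section

/-! ## Representations of preprojective algebras

A finite graph with vertex set `V`, together with an orientation of its edges, is encoded by the
number `m i j` of edges running from `i` to `j`.  The doubled quiver has two arrows for each edge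
`e : Fin (m i j)`: the arrow along the orientation, and the opposite arrow. -/

/-- A finite-dimensional module over the preprojective algebra (over `ℂ`) of the oriented graph `m`,
given as a vector space `X i` (`= e_i M`) for every vertex and a linear map for each of the two
arrows `fwd e`, `bwd e` of the doubled quiver attached to an edge `e`, subject to the preprojective
relation `∑_{a : head a = i} ε(a) a ā = 0` at every vertex `i`, where `ε = 1` on the arrows along
the orientation and `ε = -1` on the opposite ones. -/
structure PreprojRep {V : Type} [Fintype V] (m : V → V → ℕ) where
  X : V → Type
  [addCommGroup : ∀ i, AddCommGroup (X i)]
  [module : ∀ i, Module ℂ (X i)]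
  [finiteDimensional : ∀ i, FiniteDimensional ℂ (X i)]
  fwd : ∀ {i j : V}, Fin (m i j) → (X i →ₗ[ℂ] X j)
  bwd : ∀ {i j : V}, Fin (m i j) → (X j →ₗ[ℂ] X i)
  rel : ∀ (i : V) (x : X i),
    ∑ j, ∑ e : Fin (m j i), fwd e (bwd e x) - ∑ j, ∑ e : Fin (m i j), bwd e (fwd e x) = 0

attribute [instance] PreprojRep.addCommGroup PreprojRep.module PreprojRep.finiteDimensional

namespace PreprojRep

variable {V : Type} [Fintype V] {m : V → V → ℕ}

/-- The dimension vector. -/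
def dim (M : PreprojRep m) (i : V) : ℕ := Module.finrank ℂ (M.X i)

/-- Isomorphism of modules. -/
def Iso (M N : PreprojRep m) : Prop :=
  ∃ φ : ∀ i, M.X i ≃ₗ[ℂ] N.X i,
    (∀ (i j : V) (e : Fin (m i j)) (x : M.X i), φ j (M.fwd e x) = N.fwd e (φ i x)) ∧
    (∀ (i j : V) (e : Fin (m i j)) (x : M.X j), φ i (M.bwd e x) = N.bwd e (φ j x))

/-- The direct sum of two modules. -/
def directSum (M N : PreprojRep m) : PreprojRep m where
  X i := M.X i × N.X i
  fwd e := (M.fwd e).prodMap (N.fwd e)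
  bwd e := (M.bwd e).prodMap (N.bwd e)
  rel i x := by
    ext
    · simpa [Prod.fst_sum] using M.rel i x.1
    · simpa [Prod.snd_sum] using N.rel i x.2

/-- The direct sum of a finite family of modules. -/
def bigSum {n : ℕ} (M : Fin n → PreprojRep m) : PreprojRep m where
  X i := ∀ k, (M k).X i
  fwd e := LinearMap.pi fun k => (M k).fwd e ∘ₗ LinearMap.proj k
  bwd e := LinearMap.pi fun k => (M k).bwd e ∘ₗ LinearMap.proj k
  rel i x := by
    funext k
    simpa [Finset.sum_apply] using (M k).rel i (x k)

/-- The module `⨁ i, S_i ^ (n i)`, where `S_i` is the vertex simple module at `i`: it is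
one-dimensional, concentrated at the vertex `i`, and all arrows act on it by zero. -/
def vertexSimples (n : V → ℕ) : PreprojRep m where
  X i := Fin (n i) → ℂ
  fwd _ := 0
  bwd _ := 0
  rel i x := by simp

/-- A submodule. -/
structure Sub (M : PreprojRep m) where
  carrier : ∀ i, Submodule ℂ (M.X i)
  fwd_mem : ∀ {i j : V} (e : Fin (m i j)) (x : M.X i), x ∈ carrier i → M.fwd e x ∈ carrier j
  bwd_mem : ∀ {i j : V} (e : Fin (m i j)) (x : M.X j), x ∈ carrier j → M.bwd e x ∈ carrier i

namespace Sub

variable {M : PreprojRep m}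

/-- The dimension vector of a submodule. -/
def dim (N : Sub M) (i : V) : ℕ := Module.finrank ℂ (N.carrier i)

def IsZero (N : Sub M) : Prop := ∀ i, N.carrier i = ⊥

def IsFull (N : Sub M) : Prop := ∀ i, N.carrier i = ⊤

def Le (N P : Sub M) : Prop := ∀ i, N.carrier i ≤ P.carrier i

/-- The subquotient `P / N` of `M`, for submodules `N ⊆ P` (in general, `P / (N ∩ P)`). -/
def subquotient (N P : Sub M) : PreprojRep m where
  X i := P.carrier i ⧸ (N.carrier i).comap (P.carrier i).subtype
  fwd {i j} e := Submodule.mapQ _ _ ((M.fwd e).restrict fun x hx => P.fwd_mem e x hx)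
    (fun x hx => N.fwd_mem e x.1 hx)
  bwd {i j} e := Submodule.mapQ _ _ ((M.bwd e).restrict fun x hx => P.bwd_mem e x hx)
    (fun x hx => N.bwd_mem e x.1 hx)
  rel i x := by
    obtain ⟨y, rfl⟩ := Submodule.Quotient.mk_surjective _ x
    have h : (∑ j, ∑ e : Fin (m j i),
          (⟨M.fwd e (M.bwd e y.1), P.fwd_mem e _ (P.bwd_mem e _ y.2)⟩ : P.carrier i)) -
        ∑ j, ∑ e : Fin (m i j),
          (⟨M.bwd e (M.fwd e y.1), P.bwd_mem e _ (P.fwd_mem e _ y.2)⟩ : P.carrier i) = 0 := by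
      ext
      simpa using M.rel i y.1
    have h' := congrArg (Submodule.mkQ ((N.carrier i).comap (P.carrier i).subtype)) h
    simp only [map_sub, map_sum, map_zero] at h'
    exact h'

end Sub

/-! ## Stability -/

/-- `θ(d) = ∑ i, θ_i d_i` for a stability parameter `θ` and a dimension vector `d`. -/
def pairing (θ : V → ℚ) (d : V → ℕ) : ℚ := ∑ i, θ i * d i

/-- `M` is `θ`-semistable. -/
def IsSemistable (θ : V → ℚ) (M : PreprojRep m) : Prop :=
  pairing θ M.dim = 0 ∧ ∀ N : Sub M, ¬ N.IsZero → 0 ≤ pairing θ N.dim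

/-- `M` is `θ`-stable: it is nonzero, `θ(dim M) = 0`, and `θ(dim N) > 0` for every nonzero proper
submodule `N`. -/
def IsStable (θ : V → ℚ) (M : PreprojRep m) : Prop :=
  (∃ i, M.dim i ≠ 0) ∧ pairing θ M.dim = 0 ∧
    ∀ N : Sub M, ¬ N.IsZero → ¬ N.IsFull → 0 < pairing θ N.dim

/-- A finite filtration `0 = F_0 ⊆ F_1 ⊆ ⋯ ⊆ F_n = M` by submodules with `θ(dim F_k) = 0`. -/
structure ThetaFiltration (θ : V → ℚ) (M : PreprojRep m) where
  n : ℕ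
  F : Fin (n + 1) → Sub M
  zero : (F 0).IsZero
  full : (F (Fin.last n)).IsFull
  mono : ∀ k : Fin n, (F k.castSucc).Le (F k.succ)
  pairing_eq_zero : ∀ k, pairing θ (F k).dim = 0

/-- The associated graded module `⨁ k, F_{k+1} / F_k`. -/
def ThetaFiltration.gr {θ : V → ℚ} {M : PreprojRep m} (F : ThetaFiltration θ M) :
    PreprojRep m :=
  bigSum fun k : Fin F.n => Sub.subquotient (F.F k.castSucc) (F.F k.succ)

/-- `S_θ`-equivalence: the modules have filtrations by submodules on which `θ` vanishes, with
isomorphic associated graded modules.  (For semistable modules, such filtrations can be refined to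
Jordan–Hölder filtrations with `θ`-stable factors, so this says that the stable factors agree.) -/
def SEquiv (θ : V → ℚ) (M N : PreprojRep m) : Prop :=
  ∃ (F : ThetaFiltration θ M) (G : ThetaFiltration θ N), Iso F.gr G.gr

end PreprojRep

open PreprojRep

/-! ## The McKay quiver -/

/-- The representation of `Γ ⊆ SL(2, ℂ)` on `ℂ²`. -/
def natRep (Γ : Subgroup (Matrix.SpecialLinearGroup (Fin 2) ℂ)) :
    Representation ℂ Γ (Fin 2 → ℂ) where
  toFun g := Matrix.toLin' (g : Matrix.SpecialLinearGroup (Fin 2) ℂ).1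
  map_one' := by simp [Module.End.one_eq_id]
  map_mul' g h := by simp [Matrix.toLin'_mul, Module.End.mul_eq_comp]

/-- A list `ρ_0, …, ρ_r` of the irreducible representations of `Γ`, each isomorphism class
occurring exactly once, with `ρ_0` trivial. -/
structure IrrepList (Γ : Subgroup (Matrix.SpecialLinearGroup (Fin 2) ℂ)) (r : ℕ) where
  S : Fin (r + 1) → Type
  [addCommGroup : ∀ i, AddCommGroup (S i)]
  [module : ∀ i, Module ℂ (S i)]
  [finiteDimensional : ∀ i, FiniteDimensional ℂ (S i)]
  ρ : ∀ i, Representation ℂ Γ (S i)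
  irreducible : ∀ i, (ρ i).IsIrreducible
  distinct : ∀ i j, Nonempty ((ρ i).Equiv (ρ j)) → i = j
  complete : ∀ (T : Type) [AddCommGroup T] [Module ℂ T] [FiniteDimensional ℂ T]
    (σ : Representation ℂ Γ T), σ.IsIrreducible → ∃ i, Nonempty (σ.Equiv (ρ i))
  trivial_zero : Nonempty ((ρ 0).Equiv (Representation.trivial ℂ Γ ℂ))

attribute [instance] IrrepList.addCommGroup IrrepList.module IrrepList.finiteDimensional

namespace IrrepList

variable {Γ : Subgroup (Matrix.SpecialLinearGroup (Fin 2) ℂ)} {r : ℕ}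

/-- `dim Hom_Γ(ρ_j, ρ_i ⊗ ℂ²)`: the number of arrows between the vertices `i` and `j` in the doubled
McKay quiver `Q`, in each direction; for `i ≠ j` this is the number of edges of the McKay graph
between `i` and `j`. -/
def mckay (L : IrrepList Γ r) (i j : Fin (r + 1)) : ℕ :=
  Module.finrank ℂ (Representation.IntertwiningMap (L.ρ j) ((L.ρ i).tprod (natRep Γ)))

/-- The edges of the framed McKay graph, whose vertices are `0, …, r` (as `some i`) and `∞` (as
`none`), oriented from the smaller to the larger vertex, and from `∞` to the other vertices.  There
are `w i` edges between `∞` and `i`.  A loop of the graph gives two arrows of the doubled quiver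
from its vertex to itself; loops only occur for trivial `Γ`, where `Q` has one vertex and the two
arrows `x`, `y`. -/
def framedEdges (L : IrrepList Γ r) (w : Fin (r + 1) → ℕ) :
    Option (Fin (r + 1)) → Option (Fin (r + 1)) → ℕ
  | none, some i => w i
  | some i, some j => if i < j then L.mckay i j else if i = j then L.mckay i i / 2 else 0
  | _, none => 0

/-- Finite-dimensional modules over the framed preprojective algebra `Π^w`. -/
abbrev FramedModule (L : IrrepList Γ r) (w : Fin (r + 1) → ℕ) : Type 1 :=
  PreprojRep (L.framedEdges w)

/-- The dimension vector `(1, v)`. -/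
def framedDim (v : Fin (r + 1) → ℕ) : Option (Fin (r + 1)) → ℕ
  | none => 1
  | some i => v i

/-- The stability parameter `θ_I` for modules of dimension `(1, v)`. -/
def theta (I : Finset (Fin (r + 1))) (v : Fin (r + 1) → ℕ) : Option (Fin (r + 1)) → ℚ
  | none => - ∑ i ∈ I, (v i : ℚ)
  | some i => if i ∈ I then 1 else 0

/-- The `θ`-semistable `Π^w`-modules of dimension vector `(1, v)`. -/
structure SemistableModule (L : IrrepList Γ r) (θ : Option (Fin (r + 1)) → ℚ)
    (v w : Fin (r + 1) → ℕ) where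
  rep : L.FramedModule w
  semistable : IsSemistable θ rep
  dim_eq : rep.dim = framedDim v

/-- The set of (closed) points `𝔐_θ(v, w)(ℂ)` of the Nakajima quiver variety: the
`S_θ`-equivalence classes of `θ`-semistable `Π^w`-modules of dimension vector `(1, v)`. -/
def NQVPoints (L : IrrepList Γ r) (θ : Option (Fin (r + 1)) → ℚ) (v w : Fin (r + 1) → ℕ) :
    Type 1 :=
  Quot fun M N : L.SemistableModule θ v w => SEquiv θ M.rep N.rep

/-- The point of `𝔐_θ(v, w)(ℂ)` represented by a semistable module. -/
def NQVPoints.mk {L : IrrepList Γ r} {θ : Option (Fin (r + 1)) → ℚ} {v w : Fin (r + 1) → ℕ}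
    (M : L.SemistableModule θ v w) : L.NQVPoints θ v w :=
  Quot.mk _ M

/-- `⨁_{i ∉ I} S_i ^ (n i)`, a direct sum of vertex simple `Π^w`-modules. -/
def simplesOff (L : IrrepList Γ r) (w : Fin (r + 1) → ℕ) (I : Finset (Fin (r + 1)))
    (n : Fin (r + 1) → ℕ) : L.FramedModule w :=
  vertexSimples fun
    | none => 0
    | some i => if i ∈ I then 0 else n i

end IrrepList

/-! ## Graded vector spaces

The degree zero part `Π_0` is `⨁_{i ∈ Q_0} ℂ e_i`, so a `Π_0`-module is a family of vector spaces
indexed by `Q_0 = {0, …, r}`; likewise a `Π_{I,0}`-module is a family indexed by `I`. -/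

/-- The dimension vector of a family of vector spaces. -/
def dimVec {r : ℕ} (U : Fin (r + 1) → Type*) [∀ i, AddCommGroup (U i)] [∀ i, Module ℂ (U i)]
    (i : Fin (r + 1)) : ℕ :=
  Module.finrank ℂ (U i)

/-- `U` is sufficient with respect to `I`: for every vertex `i ∉ I`, `2 dim U_i` is at least the sum
of `dim U_j` over the edges of the McKay graph joining `i` to another vertex `j`. -/
def Sufficient {Γ : Subgroup (Matrix.SpecialLinearGroup (Fin 2) ℂ)} {r : ℕ} (L : IrrepList Γ r)
    (I : Finset (Fin (r + 1))) (U : Fin (r + 1) → Type*) [∀ i, AddCommGroup (U i)]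
    [∀ i, Module ℂ (U i)] : Prop :=
  ∀ i, i ∉ I → ∑ j, L.mckay i j * dimVec U j ≤ 2 * dimVec U i

end

end McKayNQV

open McKayNQV McKayNQV.PreprojRep McKayNQV.IrrepList

/-! Put `J = I ∪ {∞}` (`frameSet I`). The key fact is that the `S_θ`-class of a `θ_I`-semistable
module `M` of dimension `(1, v)` is determined by `e_J M` over `e_J Π^w e_J`. That algebra is
avoided: `EquivOn J M N` asks for a submodule of `M × N` that is the graph of a bijection at each
vertex of `J`. This is an equivalence relation, insensitive to summands, submodules and quotients
supported off `J`.

`S_θ`-equivalence implies `EquivOn`: a submodule on which `θ_I` vanishes is zero on `J` or full on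
`J`, according to its dimension at `∞` (`HasDimOn.bot_or_top`). Hence a filtration jumps exactly
once on `J`, and `M` is related to its associated graded module.

Conversely, Goursat's lemma turns a correspondence into isomorphic subquotients of `M` and `N` that
see all of `J`. What is left over lives off `J`, where modules are iterated extensions of vertex
simples (`PosOff.exists_killed`), so filtrations exist whose remaining layers are trivial and are
fixed by the dimension vector (`EquivOn.sEquiv`). The nilpotency off `J` combines the preprojective
relation (`two_mul_dim_le`) with positivity of the Cartan form on vectors vanishing at some vertex.
The latter is the character identity `card_mul_cartan`, a sum of terms `|χ(g)|² (2 - tr g)` with `Re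
tr g < 2` for `g ≠ 1`.

Adding vertex simples off `I` does not change the class on `J`, so `f` is well defined and
injective, and from a polystable module only the summand at `∞` matters. For surjectivity, a module
is replaced by a related one of least total dimension. It has no simple submodule or quotient at a
vertex off `I`, so for `W` supported on `I` positivity bounds its dimension vector by the sufficient
vector `dim U`, and vertex simples fill the gap. -/

namespace McKayNQV
namespace PreprojRep

variable {V : Type} [Fintype V] {m : V → V → ℕ}

/-- The arrows of the doubled quiver from `i` to `j`. -/
abbrev Arrow (m : V → V → ℕ) (i j : V) : Type := Fin (m i j) ⊕ Fin (m j i)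

/-- The action of an arrow of the doubled quiver. -/
def act (M : PreprojRep m) {i j : V} : Arrow m i j → (M.X i →ₗ[ℂ] M.X j)
  | .inl e => M.fwd e
  | .inr e => M.bwd e

/-- The total dimension. -/
noncomputable def total (M : PreprojRep m) : ℕ := ∑ i, M.dim i

/-! ### Submodules -/

namespace Sub

variable {M : PreprojRep m}

/-- A submodule, from a family of subspaces stable under all arrows. -/
def ofAct (c : ∀ i, Submodule ℂ (M.X i))
    (h : ∀ {i j : V} (a : Arrow m i j) (x : M.X i), x ∈ c i → M.act a x ∈ c j) : Sub M where
  carrier := c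
  fwd_mem e x hx := h (.inl e) x hx
  bwd_mem e x hx := h (.inr e) x hx

theorem act_mem (N : Sub M) {i j : V} (a : Arrow m i j) {x : M.X i} (hx : x ∈ N.carrier i) :
    M.act a x ∈ N.carrier j := by
  cases a with
  | inl e => exact N.fwd_mem e x hx
  | inr e => exact N.bwd_mem e x hx

theorem ext_carrier {N P : Sub M} (h : ∀ i, N.carrier i = P.carrier i) : N = P := by
  cases N; cases P
  congr
  exact funext h

theorem dim_le (N : Sub M) (i : V) : N.dim i ≤ M.dim i :=
  Submodule.finrank_le _

theorem dim_eq_zero_iff (N : Sub M) (i : V) : N.dim i = 0 ↔ N.carrier i = ⊥ :=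
  Submodule.finrank_eq_zero

theorem eq_top_of_dim_eq (N : Sub M) {i : V} (h : N.dim i = M.dim i) : N.carrier i = ⊤ :=
  Submodule.eq_top_of_finrank_eq h

theorem dim_of_eq_bot (N : Sub M) {i : V} (h : N.carrier i = ⊥) : N.dim i = 0 :=
  (N.dim_eq_zero_iff i).2 h

theorem dim_of_eq_top (N : Sub M) {i : V} (h : N.carrier i = ⊤) : N.dim i = M.dim i := by
  rw [Sub.dim, h]
  exact finrank_top ℂ (M.X i)

/-- The zero submodule. -/
def zero (M : PreprojRep m) : Sub M := ofAct (fun _ => ⊥) (by simp)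

/-- The whole module as a submodule. -/
def full (M : PreprojRep m) : Sub M := ofAct (fun _ => ⊤) (by simp)

/-- A submodule as a module. -/
def toRep (N : Sub M) : PreprojRep m where
  X i := N.carrier i
  fwd e := (M.fwd e).restrict fun x hx => N.fwd_mem e x hx
  bwd e := (M.bwd e).restrict fun x hx => N.bwd_mem e x hx
  rel i x := by
    ext
    simpa using M.rel i x.1

theorem toRep_act (N : Sub M) {i j : V} (a : Arrow m i j) (x : N.carrier i) :
    (show N.carrier j from N.toRep.act a x).1 = M.act a x.1 := by
  cases a <;> rfl

/-- The projection from a submodule to a subquotient. -/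
def toSubquotient (N P : Sub M) (i : V) : P.carrier i →ₗ[ℂ] (subquotient N P).X i :=
  Submodule.mkQ _

theorem toSubquotient_surjective (N P : Sub M) (i : V) :
    Function.Surjective (toSubquotient N P i) :=
  Submodule.mkQ_surjective _

theorem toSubquotient_eq_zero (N P : Sub M) {i : V} (x : P.carrier i) :
    toSubquotient N P i x = 0 ↔ x.1 ∈ N.carrier i :=
  Submodule.Quotient.mk_eq_zero _

theorem act_toSubquotient (N P : Sub M) {i j : V} (a : Arrow m i j) (x : P.carrier i) :
    (subquotient N P).act a (toSubquotient N P i x) =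
      toSubquotient N P j ⟨M.act a x.1, P.act_mem a x.2⟩ := by
  cases a <;> rfl

theorem subquotient_dim {N P : Sub M} (h : N.Le P) (i : V) :
    N.dim i + (subquotient N P).dim i = P.dim i := by
  have h1 := Submodule.finrank_quotient_add_finrank ((N.carrier i).comap (P.carrier i).subtype)
  have h2 : Module.finrank ℂ ((N.carrier i).comap (P.carrier i).subtype) = N.dim i :=
    (Submodule.comapSubtypeEquivOfLe (h i)).finrank_eq
  rw [h2] at h1
  rw [add_comm]
  exact h1

end Sub

/-! ### Isomorphisms -/

theorem Iso.mk {M N : PreprojRep m} (φ : ∀ i, M.X i ≃ₗ[ℂ] N.X i)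
    (h : ∀ {i j : V} (a : Arrow m i j) (x : M.X i), φ j (M.act a x) = N.act a (φ i x)) :
    Iso M N :=
  ⟨φ, fun _ _ e x => h (.inl e) x, fun _ _ e x => h (.inr e) x⟩

theorem Iso.exists_act {M N : PreprojRep m} (h : Iso M N) :
    ∃ φ : ∀ i, M.X i ≃ₗ[ℂ] N.X i, ∀ {i j : V} (a : Arrow m i j) (x : M.X i),
      φ j (M.act a x) = N.act a (φ i x) := by
  obtain ⟨φ, h1, h2⟩ := h
  refine ⟨φ, fun a x => ?_⟩
  cases a with
  | inl e => exact h1 _ _ e x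
  | inr e => exact h2 _ _ e x

theorem Iso.refl (M : PreprojRep m) : Iso M M :=
  Iso.mk (fun _ => LinearEquiv.refl ℂ _) fun _ _ => rfl

theorem Iso.of_eq {M N : PreprojRep m} (h : M = N) : Iso M N := h ▸ Iso.refl M

theorem Iso.symm {M N : PreprojRep m} (h : Iso M N) : Iso N M := by
  obtain ⟨φ, h⟩ := h.exists_act
  refine Iso.mk (fun i => (φ i).symm) fun a x => ?_
  rw [LinearEquiv.symm_apply_eq, h, LinearEquiv.apply_symm_apply]

theorem Iso.trans {M N P : PreprojRep m} (h : Iso M N) (h' : Iso N P) : Iso M P := by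
  obtain ⟨φ, h⟩ := h.exists_act
  obtain ⟨ψ, h'⟩ := h'.exists_act
  refine Iso.mk (fun i => (φ i).trans (ψ i)) fun a x => ?_
  simp [h, h']

theorem Iso.dim_eq {M N : PreprojRep m} (h : Iso M N) (i : V) : M.dim i = N.dim i :=
  (h.choose i).finrank_eq

theorem directSum_act (M N : PreprojRep m) {i j : V} (a : Arrow m i j) (x : M.X i) (y : N.X i) :
    (M.directSum N).act a (x, y) = (M.act a x, N.act a y) := by
  cases a <;> rfl

theorem bigSum_act {n : ℕ} (A : Fin n → PreprojRep m) {i j : V} (a : Arrow m i j)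
    (x : ∀ k, (A k).X i) (k : Fin n) :
    (show ∀ k, (A k).X j from (bigSum A).act a x) k = (A k).act a (x k) := by
  cases a <;> rfl

theorem directSum_dim (M N : PreprojRep m) (i : V) :
    (M.directSum N).dim i = M.dim i + N.dim i :=
  Module.finrank_prod (R := ℂ) (M := M.X i) (M' := N.X i)

theorem bigSum_dim {n : ℕ} (A : Fin n → PreprojRep m) (i : V) :
    (bigSum A).dim i = ∑ k, (A k).dim i :=
  Module.finrank_pi_fintype ℂ (M := fun k => (A k).X i)

theorem vertexSimples_dim (n : V → ℕ) (i : V) : (vertexSimples (m := m) n).dim i = n i :=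
  Module.finrank_fin_fun ℂ

theorem Iso.directSum {M M' N N' : PreprojRep m} (h : Iso M M') (h' : Iso N N') :
    Iso (M.directSum N) (M'.directSum N') := by
  obtain ⟨φ, h⟩ := h.exists_act
  obtain ⟨ψ, h'⟩ := h'.exists_act
  refine Iso.mk (fun i => LinearEquiv.prodCongr (φ i) (ψ i)) fun {i j} a x => ?_
  obtain ⟨x, y⟩ := x
  have := directSum_act M' N' a (φ i x) (ψ i y)
  rw [← h, ← h'] at this
  refine Eq.trans ?_ this.symm
  rw [directSum_act]
  rfl

theorem directSum_assoc (M N P : PreprojRep m) :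
    Iso ((M.directSum N).directSum P) (M.directSum (N.directSum P)) := by
  refine Iso.mk (fun i =>
    { toFun := fun x => (x.1.1, (x.1.2, x.2))
      invFun := fun x => ((x.1, x.2.1), x.2.2)
      left_inv := fun _ => rfl
      right_inv := fun _ => rfl
      map_add' := fun _ _ => rfl
      map_smul' := fun _ _ => rfl }) fun a x => ?_
  cases a <;> rfl

theorem directSum_comm (M N : PreprojRep m) : Iso (M.directSum N) (N.directSum M) := by
  refine Iso.mk (fun i => LinearEquiv.prodComm ℂ (M.X i) (N.X i)) fun a x => ?_
  cases a <;> rfl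

theorem bigSum_congr {n : ℕ} {A B : Fin n → PreprojRep m} (h : ∀ k, Iso (A k) (B k)) :
    Iso (bigSum A) (bigSum B) := by
  choose φ hφ using fun k => (h k).exists_act
  refine Iso.mk (fun i => LinearEquiv.piCongrRight fun k => φ k i) fun {i j} a x => ?_
  funext k
  refine Eq.trans ?_ (bigSum_act B a _ k).symm
  refine Eq.trans ?_ (hφ k a (x k))
  exact congrArg (φ k j) (bigSum_act A a x k)

theorem bigSum_succ {n : ℕ} (A : Fin (n + 1) → PreprojRep m) :
    Iso (bigSum A) ((bigSum fun k : Fin n => A k.castSucc).directSum (A (Fin.last n))) := by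
  refine Iso.mk (fun i =>
    { toFun := fun x => (fun k => x k.castSucc, x (Fin.last n))
      invFun := fun x => Fin.snoc (α := fun k => (A k).X i) x.1 x.2
      left_inv := fun x => by
        funext k
        refine Fin.lastCases ?_ (fun k => ?_) k
        · simp
        · simp
      right_inv := fun x => by
        refine Prod.ext ?_ ?_
        · funext k
          exact Fin.snoc_castSucc (α := fun k => (A k).X i) _ _ _
        · exact Fin.snoc_last (α := fun k => (A k).X i) _ _
      map_add' := fun _ _ => rfl
      map_smul' := fun _ _ => rfl }) fun a x => ?_
  cases a <;> rfl

/-- Modules on which all arrows act by zero. -/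
def IsTrivial (M : PreprojRep m) : Prop :=
  ∀ {i j : V} (a : Arrow m i j) (x : M.X i), M.act a x = 0

theorem vertexSimples_isTrivial (n : V → ℕ) : (vertexSimples (m := m) n).IsTrivial := by
  intro i j a x
  cases a <;> rfl

/-- With zero arrows every choice of linear isomorphisms at the vertices is compatible, so the
layers off `J` can be compared by counting dimensions. -/
theorem IsTrivial.iso {M N : PreprojRep m} (hM : M.IsTrivial) (hN : N.IsTrivial)
    (h : ∀ i, M.dim i = N.dim i) : Iso M N :=
  Iso.mk (fun i => LinearEquiv.ofFinrankEq _ _ (h i)) fun a x => by rw [hM, hN, map_zero]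

theorem IsTrivial.directSum {M N : PreprojRep m} (hM : M.IsTrivial) (hN : N.IsTrivial) :
    (M.directSum N).IsTrivial := by
  intro i j a x
  obtain ⟨x, y⟩ := x
  rw [directSum_act, hM, hN]
  rfl

/-! ### Correspondences -/

/-- A correspondence between two modules: a submodule of their product. -/
structure Corr (M N : PreprojRep m) where
  carrier : ∀ i, Submodule ℂ (M.X i × N.X i)
  act_mem : ∀ {i j : V} (a : Arrow m i j) {x : M.X i} {y : N.X i},
    (x, y) ∈ carrier i → (M.act a x, N.act a y) ∈ carrier j

/-- Two modules are related on `J` if some correspondence between them is the graph of a bijection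
at every vertex of `J`. -/
def EquivOn (J : Set V) (M N : PreprojRep m) : Prop :=
  ∃ R : Corr M N, ∀ j ∈ J, (∀ x, ∃ y, (x, y) ∈ R.carrier j) ∧ (∀ y, ∃ x, (x, y) ∈ R.carrier j) ∧
    (∀ x, (x, 0) ∈ R.carrier j → x = 0) ∧ (∀ y, (0, y) ∈ R.carrier j → y = 0)

namespace EquivOn

variable {J : Set V}

theorem symm {M N : PreprojRep m} (h : EquivOn J M N) : EquivOn J N M := by
  obtain ⟨R, hR⟩ := h
  refine ⟨⟨fun i => (R.carrier i).comap (LinearEquiv.prodComm ℂ (N.X i) (M.X i)).toLinearMap,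
    fun a x y h => R.act_mem a h⟩, fun j hj => ?_⟩
  obtain ⟨h1, h2, h3, h4⟩ := hR j hj
  exact ⟨h2, h1, h4, h3⟩

/-- Relational composition. It yields a submodule with no condition off `J`, which is why
correspondences are used rather than homomorphisms. -/
theorem trans {M N P : PreprojRep m} (h : EquivOn J M N) (h' : EquivOn J N P) :
    EquivOn J M P := by
  obtain ⟨R, hR⟩ := h
  obtain ⟨S, hS⟩ := h'
  refine ⟨⟨fun i =>
    { carrier := {p | ∃ y, (p.1, y) ∈ R.carrier i ∧ (y, p.2) ∈ S.carrier i}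
      zero_mem' := ⟨0, (R.carrier i).zero_mem, (S.carrier i).zero_mem⟩
      add_mem' := fun {p q} ⟨y, h1, h2⟩ ⟨z, h3, h4⟩ =>
        ⟨y + z, (R.carrier i).add_mem h1 h3, (S.carrier i).add_mem h2 h4⟩
      smul_mem' := fun c p ⟨y, h1, h2⟩ =>
        ⟨c • y, (R.carrier i).smul_mem c h1, (S.carrier i).smul_mem c h2⟩ },
    fun a x z ⟨y, h1, h2⟩ => ⟨_, R.act_mem a h1, S.act_mem a h2⟩⟩, fun j hj => ?_⟩
  obtain ⟨h1, h2, h3, h4⟩ := hR j hj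
  obtain ⟨k1, k2, k3, k4⟩ := hS j hj
  refine ⟨fun x => ?_, fun z => ?_, ?_, ?_⟩
  · obtain ⟨y, hy⟩ := h1 x
    obtain ⟨z, hz⟩ := k1 y
    exact ⟨z, y, hy, hz⟩
  · obtain ⟨y, hy⟩ := k2 z
    obtain ⟨x, hx⟩ := h2 y
    exact ⟨x, y, hx, hy⟩
  · rintro x ⟨y, hx, hy⟩
    obtain rfl : y = 0 := k3 y hy
    exact h3 x hx
  · rintro z ⟨y, hx, hy⟩
    obtain rfl : y = 0 := h4 y hx
    exact k4 z hy

theorem of_hom {M N : PreprojRep m} (f : ∀ i, M.X i →ₗ[ℂ] N.X i)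
    (hf : ∀ {i j : V} (a : Arrow m i j) (x : M.X i), f j (M.act a x) = N.act a (f i x))
    (hJ : ∀ j ∈ J, Function.Bijective (f j)) : EquivOn J M N := by
  refine ⟨⟨fun i => (f i).graph, fun a x y h => ?_⟩, fun j hj => ⟨fun x => ?_, fun y => ?_, ?_, ?_⟩⟩
  · rw [LinearMap.mem_graph_iff] at h ⊢
    simp only at h ⊢
    rw [hf, h]
  · exact ⟨f j x, by simp⟩
  · obtain ⟨x, hx⟩ := (hJ j hj).2 y
    exact ⟨x, by simp [hx]⟩
  · intro x hx
    refine (hJ j hj).1 ?_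
    simpa using hx.symm
  · intro y hy
    simpa using hy

theorem refl (M : PreprojRep m) : EquivOn J M M :=
  of_hom (fun _ => LinearMap.id) (fun _ _ => rfl) fun _ _ => Function.bijective_id

theorem of_iso {M N : PreprojRep m} (h : Iso M N) : EquivOn J M N := by
  obtain ⟨φ, h⟩ := h.exists_act
  exact of_hom (fun i => (φ i).toLinearMap) h fun j _ => (φ j).bijective

theorem toRep {M : PreprojRep m} (N : Sub M) (h : ∀ j ∈ J, N.carrier j = ⊤) :
    EquivOn J N.toRep M := by
  refine of_hom (fun i => (N.carrier i).subtype) (fun a x => N.toRep_act a x) fun j hj => ?_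
  refine ⟨Subtype.val_injective, fun x => ⟨⟨x, ?_⟩, rfl⟩⟩
  rw [h j hj]
  trivial

/-- The zigzag `M ← P → P / N` has both legs bijective on `J`. -/
theorem subquotient {M : PreprojRep m} (N P : Sub M) (hN : ∀ j ∈ J, N.carrier j = ⊥)
    (hP : ∀ j ∈ J, P.carrier j = ⊤) : EquivOn J M (Sub.subquotient N P) := by
  refine (toRep P hP).symm.trans (of_hom (Sub.toSubquotient N P) ?_ ?_)
  · intro i j a x
    exact (congrArg (Sub.toSubquotient N P j) (Subtype.ext (P.toRep_act a x))).trans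
      (Sub.act_toSubquotient N P a x).symm
  · refine fun j hj => ⟨?_, Sub.toSubquotient_surjective N P j⟩
    refine (injective_iff_map_eq_zero (Sub.toSubquotient N P j)).2 fun x hx => ?_
    rw [Sub.toSubquotient_eq_zero, hN j hj] at hx
    exact Subtype.ext hx

theorem directSum_left (M N : PreprojRep m) (h : ∀ j ∈ J, N.dim j = 0) :
    EquivOn J (M.directSum N) M := by
  refine of_hom (fun i => LinearMap.fst ℂ (M.X i) (N.X i)) (fun a x => ?_) fun j hj => ?_
  · cases a <;> rfl
  · have : Subsingleton (N.X j) := Module.finrank_zero_iff.1 (h j hj)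
    exact ⟨fun x y hxy => Prod.ext hxy (Subsingleton.elim _ _), fun x => ⟨(x, 0), rfl⟩⟩

theorem bigSum {n : ℕ} (A : Fin n → PreprojRep m) (k : Fin n)
    (h : ∀ l, l ≠ k → ∀ j ∈ J, (A l).dim j = 0) : EquivOn J (bigSum A) (A k) := by
  classical
  refine of_hom (fun i => LinearMap.proj (φ := fun l => (A l).X i) k) (fun a x => ?_)
    fun j hj => ⟨fun x y hxy => ?_, LinearMap.proj_surjective (φ := fun l => (A l).X j) k⟩
  · cases a <;> rfl
  · funext l
    by_cases hl : l = k
    · subst hl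
      exact hxy
    · have : Subsingleton ((A l).X j) := Module.finrank_zero_iff.1 (h l hl j hj)
      exact Subsingleton.elim _ _

theorem dim_eq {M N : PreprojRep m} (h : EquivOn J M N) {j : V} (hj : j ∈ J) :
    M.dim j = N.dim j := by
  obtain ⟨R, hR⟩ := h
  obtain ⟨h1, h2, h3, h4⟩ := hR j hj
  have e1 : (R.carrier j) ≃ₗ[ℂ] M.X j :=
    LinearEquiv.ofBijective ((LinearMap.fst ℂ (M.X j) (N.X j)).domRestrict (R.carrier j)) ⟨by
      rw [injective_iff_map_eq_zero]
      rintro ⟨⟨x, y⟩, hxy⟩ hx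
      obtain rfl : x = 0 := hx
      obtain rfl := h4 y hxy
      rfl, fun x => by
      obtain ⟨y, hy⟩ := h1 x
      exact ⟨⟨(x, y), hy⟩, rfl⟩⟩
  have e2 : (R.carrier j) ≃ₗ[ℂ] N.X j :=
    LinearEquiv.ofBijective ((LinearMap.snd ℂ (M.X j) (N.X j)).domRestrict (R.carrier j)) ⟨by
      rw [injective_iff_map_eq_zero]
      rintro ⟨⟨x, y⟩, hxy⟩ hx
      obtain rfl : y = 0 := hx
      obtain rfl := h3 x hxy
      rfl, fun y => by
      obtain ⟨x, hx⟩ := h2 y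
      exact ⟨⟨(x, y), hx⟩, rfl⟩⟩
  exact e1.finrank_eq.symm.trans e2.finrank_eq

/-- Submodules that are full on part of `J` transport along a correspondence. -/
theorem exists_sub {M N : PreprojRep m} (h : EquivOn J M N) (P : Sub N) :
    ∃ P' : Sub M, ∀ j ∈ J, P'.carrier j = ⊤ ↔ P.carrier j = ⊤ := by
  obtain ⟨R, hR⟩ := h
  refine ⟨Sub.ofAct (fun i =>
    { carrier := {x | ∃ y ∈ P.carrier i, (x, y) ∈ R.carrier i}
      zero_mem' := ⟨0, (P.carrier i).zero_mem, (R.carrier i).zero_mem⟩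
      add_mem' := fun ⟨y, h1, h2⟩ ⟨z, h3, h4⟩ =>
        ⟨y + z, (P.carrier i).add_mem h1 h3, (R.carrier i).add_mem h2 h4⟩
      smul_mem' := fun c x ⟨y, h1, h2⟩ =>
        ⟨c • y, (P.carrier i).smul_mem c h1, (R.carrier i).smul_mem c h2⟩ })
    fun a x ⟨y, h1, h2⟩ => ⟨_, P.act_mem a h1, R.act_mem a h2⟩, fun j hj => ?_⟩
  obtain ⟨h1, h2, h3, h4⟩ := hR j hj
  rw [Submodule.eq_top_iff', Submodule.eq_top_iff']
  constructor
  · intro h y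
    obtain ⟨x, hx⟩ := h2 y
    obtain ⟨z, hz, hxz⟩ := h x
    -- The difference is `(0, y - z)`, so injectivity on `J` gives `y = z`, which lies in `P`.
    have := (R.carrier j).sub_mem hx hxz
    rw [Prod.mk_sub_mk, sub_self] at this
    rwa [sub_eq_zero.1 (h4 _ this)]
  · intro h x
    obtain ⟨y, hy⟩ := h1 x
    exact ⟨y, h y, hy⟩

end EquivOn

/-! ### Goursat's lemma -/

theorem exists_equiv_of_ker_eq {R A B : Type} [AddCommGroup R] [Module ℂ R] [AddCommGroup A]
    [Module ℂ A] [AddCommGroup B] [Module ℂ B] (f : R →ₗ[ℂ] A) (g : R →ₗ[ℂ] B)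
    (hf : Function.Surjective f) (hg : Function.Surjective g) (h : ∀ x, f x = 0 ↔ g x = 0) :
    ∃ e : A ≃ₗ[ℂ] B, ∀ x, e (f x) = g x := by
  have hk : LinearMap.ker f = LinearMap.ker g := by
    ext x
    simpa using h x
  refine ⟨(f.quotKerEquivOfSurjective hf).symm ≪≫ₗ Submodule.quotEquivOfEq _ _ hk ≪≫ₗ
    g.quotKerEquivOfSurjective hg, fun x => ?_⟩
  have : (f.quotKerEquivOfSurjective hf).symm (f x) = Submodule.Quotient.mk x := by
    rw [LinearEquiv.symm_apply_eq]
    rfl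
  simp only [LinearEquiv.trans_apply, this]
  rfl

namespace Corr

variable {M N : PreprojRep m}

/-- The projection to the first factor. -/
def range (R : Corr M N) : Sub M :=
  Sub.ofAct (fun i => (R.carrier i).map (LinearMap.fst ℂ (M.X i) (N.X i))) (by
    rintro i j a _ ⟨⟨x, y⟩, h, rfl⟩
    exact ⟨_, R.act_mem a h, rfl⟩)

/-- The intersection with the first factor. -/
def ker (R : Corr M N) : Sub M :=
  Sub.ofAct (fun i => (R.carrier i).comap (LinearMap.inl ℂ (M.X i) (N.X i))) (by
    intro i j a x h
    have h' : (M.act a x, N.act a 0) ∈ R.carrier j := R.act_mem a h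
    rwa [map_zero] at h')

theorem ker_le_range (R : Corr M N) : R.ker.Le R.range := fun _ _ hx => ⟨_, hx, rfl⟩

/-- The opposite correspondence. -/
def swap (R : Corr M N) : Corr N M :=
  ⟨fun i => (R.carrier i).comap (LinearEquiv.prodComm ℂ (N.X i) (M.X i)).toLinearMap,
    fun a _ _ h => R.act_mem a h⟩

/-- The morphism from a correspondence to the first subquotient. -/
def toFirst (R : Corr M N) (i : V) : R.carrier i →ₗ[ℂ] (Sub.subquotient R.ker R.range).X i :=
  Sub.toSubquotient R.ker R.range i ∘ₗ
    ((LinearMap.fst ℂ (M.X i) (N.X i)).restrict (p := R.carrier i) (q := R.range.carrier i)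
      fun x hx => ⟨x, hx, rfl⟩)

/-- The morphism from a correspondence to the second subquotient. -/
def toSecond (R : Corr M N) (i : V) :
    R.carrier i →ₗ[ℂ] (Sub.subquotient R.swap.ker R.swap.range).X i :=
  Sub.toSubquotient R.swap.ker R.swap.range i ∘ₗ
    ((LinearMap.snd ℂ (M.X i) (N.X i)).restrict (p := R.carrier i) (q := R.swap.range.carrier i)
      fun x hx => ⟨x.swap, hx, rfl⟩)

/-- **Goursat's lemma**. -/
theorem goursat (R : Corr M N) :
    Iso (Sub.subquotient R.ker R.range) (Sub.subquotient R.swap.ker R.swap.range) := by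
  have hf : ∀ i, Function.Surjective (R.toFirst i) := by
    intro i z
    obtain ⟨⟨_, ⟨⟨x, y⟩, h, rfl⟩⟩, rfl⟩ := Sub.toSubquotient_surjective _ _ i z
    exact ⟨⟨(x, y), h⟩, rfl⟩
  have hg : ∀ i, Function.Surjective (R.toSecond i) := by
    intro i z
    obtain ⟨⟨_, ⟨⟨y, x⟩, h, rfl⟩⟩, rfl⟩ := Sub.toSubquotient_surjective _ _ i z
    exact ⟨⟨(x, y), h⟩, rfl⟩
  have hk : ∀ i x, R.toFirst i x = 0 ↔ R.toSecond i x = 0 := by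
    rintro i ⟨⟨x, y⟩, h⟩
    refine (Sub.toSubquotient_eq_zero _ _ _).trans (Iff.trans ?_
      (Sub.toSubquotient_eq_zero _ _ _).symm)
    change (x, (0 : N.X i)) ∈ R.carrier i ↔ ((0 : M.X i), y) ∈ R.carrier i
    constructor
    · intro h'
      simpa using (R.carrier i).sub_mem h h'
    · intro h'
      simpa using (R.carrier i).sub_mem h h'
  choose e he using fun i => exists_equiv_of_ker_eq _ _ (hf i) (hg i) (hk i)
  refine Iso.mk e fun {i j} a z => ?_
  obtain ⟨⟨⟨x, y⟩, h⟩, rfl⟩ := hf i z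
  rw [he]
  have h1 : (Sub.subquotient R.ker R.range).act a (R.toFirst i ⟨(x, y), h⟩) =
      R.toFirst j ⟨_, R.act_mem a h⟩ := Sub.act_toSubquotient _ _ a _
  have h2 : (Sub.subquotient R.swap.ker R.swap.range).act a (R.toSecond i ⟨(x, y), h⟩) =
      R.toSecond j ⟨_, R.act_mem a h⟩ := Sub.act_toSubquotient _ _ a _
  rw [h1, h2, he]

end Corr

/-! ### Vertices at which a module has no simple submodule and no simple quotient -/

/-- No nonzero vector at `i` is killed by all arrows. -/
def OutInjective (M : PreprojRep m) (i : V) : Prop :=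
  ∀ x : M.X i, (∀ j (a : Arrow m i j), M.act a x = 0) → x = 0

/-- The images of the arrows into `i` span. -/
def InSurjective (M : PreprojRep m) (i : V) : Prop :=
  ∀ S : Submodule ℂ (M.X i), (∀ j (a : Arrow m j i) (x : M.X j), M.act a x ∈ S) → S = ⊤

/-- The preprojective relation at `i` says that `M_i → ⨁ M_j → M_i`, the sum running over the arrows
leaving `i`, composes to zero. The first map is injective and the second surjective, so the middle
term has dimension at least `2 dim M_i`. -/
theorem two_mul_dim_le (M : PreprojRep m) (i : V) (ho : M.OutInjective i) (hi : M.InSurjective i) :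
    2 * M.dim i ≤ ∑ j, (m i j + m j i) * M.dim j := by
  let Z := ∀ j, Arrow m i j → M.X j
  let out : M.X i →ₗ[ℂ] Z := LinearMap.pi fun j => LinearMap.pi fun a => M.act a
  -- The component at an outgoing arrow returns along the opposite arrow, with the sign `ε` of the
  -- relation.
  let inn : Z →ₗ[ℂ] M.X i :=
    ∑ j, ((∑ e : Fin (m j i), M.fwd e ∘ₗ (LinearMap.proj (R := ℂ) (φ := fun _ => M.X j)
        (Sum.inr e : Arrow m i j)) -
      ∑ e : Fin (m i j), M.bwd e ∘ₗ (LinearMap.proj (R := ℂ) (φ := fun _ => M.X j)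
        (Sum.inl e : Arrow m i j))) ∘ₗ LinearMap.proj (φ := fun j => Arrow m i j → M.X j) j)
  have hinn : ∀ z, inn z = ∑ j, (∑ e : Fin (m j i), M.fwd e (z j (.inr e)) -
      ∑ e : Fin (m i j), M.bwd e (z j (.inl e))) := by
    intro z
    simp [inn, LinearMap.sum_apply]
    rfl
  have hcomp : ∀ x, inn (out x) = 0 := by
    intro x
    rw [hinn, ← M.rel i x, Finset.sum_sub_distrib]
    rfl
  have hout : Function.Injective out := by
    refine (injective_iff_map_eq_zero out).2 fun x hx => ho x fun j a => ?_
    exact congrFun (congrFun hx j) a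
  have hsurj : LinearMap.range inn = ⊤ := by
    classical
    refine hi _ fun j a x => ?_
    cases a with
    | inl e =>
      refine ⟨Pi.single j (Pi.single (Sum.inr e) x), ?_⟩
      rw [hinn, Finset.sum_eq_single j]
      · rw [Pi.single_eq_same, Finset.sum_eq_single e]
        · simp [act]
        · intro e' _ he
          rw [Pi.single_eq_of_ne (by simpa using he), map_zero]
        · simp
      · intro j' _ hj
        simp [Pi.single_eq_of_ne hj]
      · simp
    | inr e =>
      -- The minus sign cancels the one with which `bwd` enters `inn`.
      refine ⟨Pi.single j (Pi.single (Sum.inl e) (-x)), ?_⟩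
      rw [hinn, Finset.sum_eq_single j]
      · rw [Pi.single_eq_same, Finset.sum_eq_single (s := (Finset.univ : Finset (Fin (m i j)))) e]
        · simp [act]
        · intro e' _ he
          rw [Pi.single_eq_of_ne (by simpa using he), map_zero]
        · simp
      · intro j' _ hj
        simp [Pi.single_eq_of_ne hj]
      · simp
  have hZ : Module.finrank ℂ Z = ∑ j, (m i j + m j i) * M.dim j := by
    rw [Module.finrank_pi_fintype]
    refine Finset.sum_congr rfl fun j _ => ?_
    rw [Module.finrank_pi_fintype]
    simp [PreprojRep.dim]
  have h1 := LinearMap.finrank_range_of_inj hout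
  have h2 : Module.finrank ℂ (LinearMap.range inn) = M.dim i := by
    rw [hsurj]
    exact finrank_top ℂ (M.X i)
  have h3 := inn.finrank_range_add_finrank_ker
  have h4 : Module.finrank ℂ (LinearMap.range out) ≤ Module.finrank ℂ (LinearMap.ker inn) := by
    refine Submodule.finrank_mono ?_
    rintro _ ⟨x, rfl⟩
    exact hcomp x
  rw [← hZ, ← h3, h2]
  have : M.dim i ≤ Module.finrank ℂ (LinearMap.ker inn) := h1.symm.le.trans h4
  omega

/-- The submodule of vectors at `i` killed by all arrows. -/
noncomputable def killed (M : PreprojRep m) (i : V) : Sub M := by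
  classical
  exact Sub.ofAct
    (fun k => if h : i = k then h ▸ (⨅ j, ⨅ a : Arrow m i j, LinearMap.ker (M.act a)) else ⊥) (by
      intro k j a x hx
      by_cases h : i = k
      · subst h
        simp only [dite_true, Submodule.mem_iInf, LinearMap.mem_ker] at hx
        rw [hx]
        exact Submodule.zero_mem _
      · rw [dif_neg h, Submodule.mem_bot] at hx
        rw [hx, map_zero]
        exact Submodule.zero_mem _)

theorem mem_killed (M : PreprojRep m) (i : V) (x : M.X i) :
    x ∈ (M.killed i).carrier i ↔ ∀ j (a : Arrow m i j), M.act a x = 0 := by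
  simp [killed, Sub.ofAct, Submodule.mem_iInf]

theorem killed_of_ne (M : PreprojRep m) {i k : V} (h : i ≠ k) : (M.killed i).carrier k = ⊥ := by
  simp [killed, Sub.ofAct, h]

/-- The submodule that is full away from `i`, and a given subspace at `i` containing the images of
all arrows. -/
noncomputable def fullAway (M : PreprojRep m) (i : V) (S : Submodule ℂ (M.X i))
    (hS : ∀ j (a : Arrow m j i) (x : M.X j), M.act a x ∈ S) : Sub M := by
  classical
  exact Sub.ofAct (fun k => if h : i = k then h ▸ S else ⊤) (by
      intro k j a x _
      by_cases h : i = j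
      · subst h
        simpa using hS k a x
      · rw [dif_neg h]
        trivial)

theorem fullAway_same (M : PreprojRep m) (i : V) (S : Submodule ℂ (M.X i)) (hS) :
    (M.fullAway i S hS).carrier i = S := by
  simp [fullAway, Sub.ofAct]

theorem fullAway_of_ne (M : PreprojRep m) {i k : V} (S : Submodule ℂ (M.X i)) (hS) (h : i ≠ k) :
    (M.fullAway i S hS).carrier k = ⊤ := by
  simp [fullAway, Sub.ofAct, h]

theorem Sub.total_lt {M : PreprojRep m} (N : Sub M) {i : V} (h : N.carrier i ≠ ⊤) :
    N.toRep.total < M.total :=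
  Finset.sum_lt_sum (fun j _ => N.dim_le j)
    ⟨i, Finset.mem_univ i, lt_of_le_of_ne (N.dim_le i) fun h' => h (N.eq_top_of_dim_eq h')⟩

/-- Every module is related on `J` to one with no simple submodule or quotient supported at a
vertex off `J`. -/
theorem exists_equivOn_injective_surjective (J : Set V) (M : PreprojRep m) :
    ∃ C : PreprojRep m, EquivOn J M C ∧ ∀ i ∉ J, C.OutInjective i ∧ C.InSurjective i := by
  classical
  -- Take `C` of least total dimension. Dividing out the vectors killed at `i`, or shrinking to a
  -- proper subspace at `i` that contains all incoming images, would give a smaller module still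
  -- related on `J`.
  have hex : ∃ n, ∃ C : PreprojRep m, EquivOn J M C ∧ C.total = n := ⟨_, M, .refl M, rfl⟩
  obtain ⟨C, hC, hn⟩ := Nat.find_spec hex
  have hmin : ∀ C', EquivOn J M C' → C.total ≤ C'.total := fun C' h' =>
    hn.le.trans (Nat.find_min' hex ⟨C', h', rfl⟩)
  refine ⟨C, hC, fun i hi => ⟨?_, ?_⟩⟩
  · have hle : (C.killed i).Le (Sub.full C) := fun _ _ _ => trivial
    have h1 := hmin _ (hC.trans (EquivOn.subquotient (C.killed i) (Sub.full C)
      (fun j hj => C.killed_of_ne fun h => hi (h ▸ hj)) fun _ _ => rfl))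
    have h2 : ∀ k, (C.killed i).dim k + (Sub.subquotient (C.killed i) (Sub.full C)).dim k =
        C.dim k := fun k => (Sub.subquotient_dim hle k).trans (Sub.dim_of_eq_top _ rfl)
    have h3 : ∑ k, (C.killed i).dim k = 0 := by
      have : ∑ k, (C.killed i).dim k + (Sub.subquotient (C.killed i) (Sub.full C)).total =
          C.total := by
        rw [total, ← Finset.sum_add_distrib]
        exact Finset.sum_congr rfl fun k _ => h2 k
      omega
    have h4 := (Sub.dim_eq_zero_iff _ i).1 (Finset.sum_eq_zero_iff.1 h3 i (Finset.mem_univ i))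
    intro x hx
    have := (C.mem_killed i x).2 hx
    rwa [h4] at this
  · intro S hS
    by_contra hne
    have h1 := hmin _ (hC.trans (EquivOn.toRep (C.fullAway i S hS)
      fun j hj => C.fullAway_of_ne S hS fun h => hi (h ▸ hj)).symm)
    have h2 := (C.fullAway i S hS).total_lt (i := i) (by rwa [fullAway_same])
    omega

/-! ### Positivity off `J` and nilpotency -/

/-- Positivity of the Cartan form of the graph off `J`. -/
def PosOff (m : V → V → ℕ) (J : Set V) : Prop :=
  ∀ d : V → ℕ, (∀ j ∈ J, d j = 0) →
    (∀ i, d i ≠ 0 → 2 * d i ≤ ∑ j, (m i j + m j i) * d j) → d = 0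

/-- If no nonzero vector is killed, the outgoing maps are injective at every vertex. Were the
incoming maps also surjective everywhere, `two_mul_dim_le` would contradict positivity. Otherwise
there is a proper submodule on which to induct. -/
theorem PosOff.exists_killed {J : Set V} (hJ : PosOff m J) (M : PreprojRep m)
    (h0 : ∀ j ∈ J, M.dim j = 0) (hM : ∃ i, M.dim i ≠ 0) :
    ∃ i, ∃ x : M.X i, x ≠ 0 ∧ ∀ j (a : Arrow m i j), M.act a x = 0 := by
  induction hn : M.total using Nat.strong_induction_on generalizing M with
  | _ n ih =>
  subst hn
  by_contra hcon
  push Not at hcon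
  have hinj : ∀ i, M.OutInjective i := by
    intro i x hx
    by_contra hne
    obtain ⟨j, a, ha⟩ := hcon i x hne
    exact ha (hx j a)
  by_cases hs : ∀ i, M.InSurjective i
  · obtain ⟨i, hi⟩ := hM
    exact hi (congrFun (hJ M.dim h0 fun i _ => M.two_mul_dim_le i (hinj i) (hs i)) i)
  · simp only [InSurjective, not_forall] at hs
    obtain ⟨i, S, hS, hne⟩ := hs
    set N := M.fullAway i S hS with hN
    -- If `N` is nonzero, a killed vector of `N` is killed in `M`. If `N` is zero, then `M` is
    -- concentrated at `i` and `S = ⊥`, so even the loops at `i` act by zero.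
    by_cases hz : ∃ k, N.toRep.dim k ≠ 0
    · obtain ⟨k, ⟨x, hxN⟩, hx, hk⟩ := ih _ (N.total_lt (i := i) (by rwa [hN, fullAway_same]))
        N.toRep (fun j hj => by
          have := N.dim_le j
          rw [h0 j hj] at this
          exact Nat.le_zero.1 this) hz rfl
      obtain ⟨j, a, ha⟩ := hcon k x fun h => hx (Subtype.ext h)
      refine ha ?_
      have := N.toRep_act a ⟨x, hxN⟩
      rw [hk j a] at this
      exact this.symm
    · push Not at hz
      have hz' : ∀ k, N.carrier k = ⊥ := fun k => (N.dim_eq_zero_iff k).1 (hz k)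
      have hzero : ∀ k, k ≠ i → M.dim k = 0 := by
        intro k hk
        rw [← N.dim_of_eq_top (M.fullAway_of_ne S hS hk.symm)]
        exact hz k
      have hSbot : S = ⊥ := by rw [← M.fullAway_same i S hS, ← hN, hz']
      obtain ⟨k, hk⟩ := hM
      obtain rfl : k = i := by
        by_contra h
        exact hk (hzero k h)
      have hnt : Nontrivial (M.X k) := Module.nontrivial_of_finrank_pos (Nat.pos_of_ne_zero hk)
      obtain ⟨x, hx⟩ := exists_ne (0 : M.X k)
      obtain ⟨j, a, ha⟩ := hcon k x hx
      by_cases hj : j = k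
      · subst hj
        have := hS j a x
        rw [hSbot] at this
        exact ha this
      · have : Subsingleton (M.X j) := Module.finrank_zero_iff.1 (hzero j hj)
        exact ha (Subsingleton.elim _ _)

/-- The vectors of `B` that all arrows map into `A`. -/
def Sub.step {M : PreprojRep m} (A B : Sub M) : Sub M :=
  Sub.ofAct (fun i => A.carrier i ⊔
      (B.carrier i ⊓ ⨅ j, ⨅ a : Arrow m i j, (A.carrier j).comap (M.act a))) (by
    intro i j a x hx
    obtain ⟨y, hy, z, ⟨-, hz⟩, rfl⟩ := Submodule.mem_sup.1 hx
    refine Submodule.mem_sup_left ?_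
    rw [map_add]
    refine add_mem (A.act_mem a hy) ?_
    simp only [SetLike.mem_coe, Submodule.mem_iInf, Submodule.mem_comap] at hz
    exact hz j a)

theorem Sub.le_step {M : PreprojRep m} (A B : Sub M) : A.Le (A.step B) :=
  fun _ => le_sup_left

theorem Sub.step_le {M : PreprojRep m} {A B : Sub M} (h : A.Le B) : (A.step B).Le B :=
  fun i => sup_le (h i) inf_le_left

theorem Sub.act_mem_of_mem_step {M : PreprojRep m} (A B : Sub M) {i j : V} (a : Arrow m i j)
    {x : M.X i} (hx : x ∈ (A.step B).carrier i) : M.act a x ∈ A.carrier j := by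
  obtain ⟨y, hy, z, ⟨-, hz⟩, rfl⟩ := Submodule.mem_sup.1 hx
  rw [map_add]
  refine add_mem (A.act_mem a hy) ?_
  simp only [SetLike.mem_coe, Submodule.mem_iInf, Submodule.mem_comap] at hz
  exact hz j a

theorem Sub.subquotient_step_isTrivial {M : PreprojRep m} (A B : Sub M) :
    (Sub.subquotient A (A.step B)).IsTrivial := by
  intro i j a z
  obtain ⟨x, rfl⟩ := Sub.toSubquotient_surjective _ _ i z
  rw [Sub.act_toSubquotient, Sub.toSubquotient_eq_zero]
  exact Sub.act_mem_of_mem_step A B a x.2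

/-- A killed vector of the quotient `B / A`, which is supported off `J`, lifts to a vector of
`A.step B` outside `A`. -/
theorem PosOff.step_ne {J : Set V} (hJ : PosOff m J) {M : PreprojRep m} {A B : Sub M}
    (hle : A.Le B) (h : ∀ j ∈ J, A.carrier j = B.carrier j) (hne : ∃ i, A.dim i ≠ B.dim i) :
    ∃ i, A.dim i < (A.step B).dim i := by
  have hdim := Sub.subquotient_dim hle
  obtain ⟨i, z, hz, hk⟩ := hJ.exists_killed (Sub.subquotient A B)
    (fun j hj => by
      have := hdim j
      have h' : A.dim j = B.dim j := by rw [Sub.dim, h j hj]; rfl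
      omega)
    (by
      obtain ⟨i, hi⟩ := hne
      refine ⟨i, fun h0 => hi ?_⟩
      have := hdim i
      omega)
  obtain ⟨x, rfl⟩ := Sub.toSubquotient_surjective _ _ i z
  refine ⟨i, Submodule.finrank_lt_finrank_of_lt (lt_of_le_of_ne (A.le_step B i) fun heq => ?_)⟩
  refine hz ((Sub.toSubquotient_eq_zero _ _ _).2 ?_)
  rw [heq]
  refine Submodule.mem_sup_right ⟨x.2, ?_⟩
  simp only [SetLike.mem_coe, Submodule.mem_iInf, Submodule.mem_comap]
  intro j a
  have := hk j a
  rwa [Sub.act_toSubquotient, Sub.toSubquotient_eq_zero] at this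

/-! ### Filtrations -/

/-- `B` has a finite filtration by submodules on which `θ` vanishes, with associated graded module
isomorphic to `X`. -/
def HasGr (θ : V → ℚ) {M : PreprojRep m} (B : Sub M) (X : PreprojRep m) : Prop :=
  ∃ (n : ℕ) (F : ℕ → Sub M), (F 0).IsZero ∧ F n = B ∧ (∀ k, (F k).Le (F (k + 1))) ∧
    (∀ k, pairing θ (F k).dim = 0) ∧ (∀ i, B.dim i = X.dim i) ∧
    Iso (bigSum fun k : Fin n => Sub.subquotient (F k) (F (k + 1))) X

theorem HasGr.congr {θ : V → ℚ} {M : PreprojRep m} {B : Sub M} {X Y : PreprojRep m}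
    (h : HasGr θ B X) (e : Iso X Y) : HasGr θ B Y := by
  obtain ⟨n, F, h0, hn, hle, hp, hd, hi⟩ := h
  exact ⟨n, F, h0, hn, hle, hp, fun i => (hd i).trans (e.dim_eq i), hi.trans e⟩

theorem HasGr.extend {θ : V → ℚ} {M : PreprojRep m} {A B : Sub M} {X : PreprojRep m}
    (h : HasGr θ A X) (hle : A.Le B) (hB : pairing θ B.dim = 0) :
    HasGr θ B (X.directSum (Sub.subquotient A B)) := by
  obtain ⟨n, F, h0, hn, hF, hp, hd, hi⟩ := h
  subst hn
  -- The sequence stays at `B` beyond `n`, so monotonicity and vanishing of `θ` hold for every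
  -- natural index.
  refine ⟨n + 1, fun k => if k ≤ n then F k else B, ?_, ?_, ?_, ?_, ?_, ?_⟩
  · simpa using h0
  · simp
  · intro k
    rcases lt_trichotomy k n with h | h | h
    · simpa [h.le, Nat.succ_le_of_lt h] using hF k
    · subst h
      simpa using hle
    · have h1 : ¬ k ≤ n := by omega
      have h2 : ¬ k + 1 ≤ n := by omega
      simp only [h1, h2, if_false]
      exact fun i => le_rfl
  · intro k
    by_cases h : k ≤ n
    · simpa [h] using hp k
    · simpa [h] using hB
  · intro i
    rw [directSum_dim, ← hd, Sub.subquotient_dim hle]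
  · refine (bigSum_succ _).trans (Iso.directSum ((bigSum_congr fun k => ?_).trans hi) ?_)
    · refine Iso.of_eq ?_
      have h1 : (k : ℕ) ≤ n := k.2.le
      have h2 : (k : ℕ) + 1 ≤ n := k.2
      simp [h1, h2]
    · refine Iso.of_eq ?_
      simp

theorem hasGr_zero (θ : V → ℚ) (M : PreprojRep m) {B : Sub M} (hB : B.IsZero) :
    HasGr θ B (vertexSimples fun _ => 0) := by
  have hd : ∀ i, B.dim i = 0 := fun i => B.dim_of_eq_bot (hB i)
  refine ⟨0, fun _ => B, hB, rfl, fun _ _ => le_rfl, fun _ => ?_, fun i => ?_, ?_⟩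
  · simp [pairing, hd]
  · rw [hd, vertexSimples_dim]
  · refine IsTrivial.iso (fun a x => ?_) (vertexSimples_isTrivial _) fun i => ?_
    · exact funext fun k => k.elim0
    · rw [vertexSimples_dim, bigSum_dim]
      rfl

/-- A filtration of `A` extends to `B` by trivial layers, if `A` and `B` agree on `J`. -/
theorem PosOff.hasGr_extend {J : Set V} (hJ : PosOff m J) {θ : V → ℚ} (hθ : ∀ i ∉ J, θ i = 0)
    {M : PreprojRep m} {A B : Sub M} (hle : A.Le B) (h : ∀ j ∈ J, A.carrier j = B.carrier j)
    (hB : pairing θ B.dim = 0) {C Z : PreprojRep m} (hZ : Z.IsTrivial)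
    (hA : HasGr θ A (C.directSum Z)) : ∃ Z', IsTrivial Z' ∧ HasGr θ B (C.directSum Z') := by
  induction hn : (∑ i, (B.dim i - A.dim i)) using Nat.strong_induction_on generalizing A Z with
  | _ n ih =>
  subst hn
  by_cases hne : ∃ i, A.dim i ≠ B.dim i
  · obtain ⟨i, hi⟩ := hJ.step_ne hle h hne
    have hstep : ∀ j ∈ J, (A.step B).carrier j = B.carrier j := fun j hj =>
      le_antisymm (Sub.step_le hle j) ((h j hj).symm.le.trans (A.le_step B j))
    have hmono : ∀ k, A.dim k ≤ (A.step B).dim k := fun k =>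
      Submodule.finrank_mono (A.le_step B k)
    have hmono' : ∀ k, (A.step B).dim k ≤ B.dim k := fun k =>
      Submodule.finrank_mono (Sub.step_le hle k)
    -- Insert `A.step B` as the next term: its layer is trivial and is absorbed into `Z`, and the
    -- remaining dimension drops.
    refine ih _ ?_ (Sub.step_le hle) hstep (hZ.directSum (Sub.subquotient_step_isTrivial A B))
      ((hA.extend (A.le_step B) ?_).congr (directSum_assoc _ _ _)) rfl
    · refine Finset.sum_lt_sum (fun k _ => ?_) ⟨i, Finset.mem_univ i, ?_⟩
      · have := hmono k
        omega
      · have := hmono' i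
        omega
    · rw [← hB]
      refine Finset.sum_congr rfl fun k _ => ?_
      by_cases hk : k ∈ J
      · rw [Sub.dim, Sub.dim, hstep k hk]
      · rw [hθ k hk, zero_mul, zero_mul]
  · push Not at hne
    obtain rfl : A = B :=
      Sub.ext_carrier fun i => Submodule.eq_of_le_of_finrank_eq (hle i) (hne i)
    exact ⟨Z, hZ, hA⟩

theorem exists_filtration_of_hasGr {θ : V → ℚ} {M : PreprojRep m} {B : Sub M} (hB : B.IsFull)
    {X : PreprojRep m} (h : HasGr θ B X) : ∃ F : ThetaFiltration θ M, Iso F.gr X := by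
  obtain ⟨n, F, h0, hn, hle, hp, -, hi⟩ := h
  subst hn
  exact ⟨⟨n, fun k => F k, h0, hB, fun k => hle k, fun k => hp k⟩, hi⟩

/-- A subquotient that sees all of `M` on `J` splits off the associated graded module of some
filtration, the rest being trivial. -/
theorem PosOff.exists_filtration {J : Set V} (hJ : PosOff m J) {θ : V → ℚ}
    (hθ : ∀ i ∉ J, θ i = 0) {M : PreprojRep m} (hM : pairing θ M.dim = 0) {K P : Sub M}
    (hle : K.Le P) (hK : ∀ j ∈ J, K.carrier j = ⊥) (hP : ∀ j ∈ J, P.carrier j = ⊤) :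
    ∃ Z, IsTrivial Z ∧ (∀ i, M.dim i = ((Sub.subquotient K P).directSum Z).dim i) ∧
      ∃ F : ThetaFiltration θ M, Iso F.gr ((Sub.subquotient K P).directSum Z) := by
  have hK0 : pairing θ K.dim = 0 := by
    refine Finset.sum_eq_zero fun k _ => ?_
    by_cases hk : k ∈ J
    · rw [K.dim_of_eq_bot (hK k hk), Nat.cast_zero, mul_zero]
    · rw [hθ k hk, zero_mul]
  have hP0 : pairing θ P.dim = 0 := by
    rw [← hM]
    refine Finset.sum_congr rfl fun k _ => ?_
    by_cases hk : k ∈ J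
    · rw [P.dim_of_eq_top (hP k hk)]
    · rw [hθ k hk, zero_mul, zero_mul]
  have htop : ∀ i, (Sub.full M).dim i = M.dim i := fun i => Sub.dim_of_eq_top _ rfl
  have hT0 : pairing θ (Sub.full M).dim = 0 := by
    rw [← hM]
    exact congrArg _ (funext htop)
  have hz : (vertexSimples (m := m) fun _ => 0).IsTrivial := vertexSimples_isTrivial _
  obtain ⟨Z, hZ, h1⟩ := hJ.hasGr_extend hθ (A := Sub.zero M) (B := K) (fun i => bot_le)
    (fun j hj => (hK j hj).symm) hK0 hz (C := vertexSimples fun _ => 0)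
    ((hasGr_zero θ M fun _ => rfl).congr (hz.iso (hz.directSum hz) fun i => by
      rw [directSum_dim, vertexSimples_dim]))
  -- The graded module of `P` is the trivial part from `K` plus `P / K`; swapping the summands makes
  -- `P / K` the fixed summand while trivial layers are added up to `M`.
  obtain ⟨Z', hZ', h2⟩ := hJ.hasGr_extend hθ (A := P) (B := Sub.full M) (fun i => le_top)
    (fun j hj => hP j hj) hT0 (hz.directSum hZ)
    ((h1.extend hle hP0).congr (directSum_comm _ _))
  refine ⟨Z', hZ', fun i => ?_, exists_filtration_of_hasGr (fun _ => rfl) h2⟩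
  obtain ⟨-, -, -, -, -, -, hd, -⟩ := h2
  rw [← htop, hd]

/-- Goursat's lemma identifies the two subquotients `range / ker`. The trivial complements then have
equal dimension vectors because `M` and `N` do, hence are isomorphic. -/
theorem EquivOn.sEquiv {J : Set V} {M N : PreprojRep m} (h : EquivOn J M N) (hJ : PosOff m J)
    {θ : V → ℚ} (hθ : ∀ i ∉ J, θ i = 0) (hM : pairing θ M.dim = 0) (hdim : M.dim = N.dim) :
    SEquiv θ M N := by
  obtain ⟨R, hR⟩ := h
  obtain ⟨Z, hZ, hd, F, hF⟩ := hJ.exists_filtration hθ hM R.ker_le_range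
    (fun j hj => (Submodule.eq_bot_iff _).2 fun x hx => (hR j hj).2.2.1 x hx)
    (fun j hj => Submodule.eq_top_iff'.2 fun x => by
      obtain ⟨y, hy⟩ := (hR j hj).1 x
      exact ⟨_, hy, rfl⟩)
  obtain ⟨Z', hZ', hd', G, hG⟩ := hJ.exists_filtration hθ (hdim ▸ hM) R.swap.ker_le_range
    (fun j hj => (Submodule.eq_bot_iff _).2 fun x hx => (hR j hj).2.2.2 x hx)
    (fun j hj => Submodule.eq_top_iff'.2 fun y => by
      obtain ⟨x, hx⟩ := (hR j hj).2.1 y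
      exact ⟨(y, x), hx, rfl⟩)
  refine ⟨F, G, hF.trans ((Iso.directSum R.goursat (hZ.iso hZ' fun i => ?_)).trans hG.symm)⟩
  have h1 := hd i
  have h2 := hd' i
  rw [directSum_dim] at h1 h2
  rw [← R.goursat.dim_eq, ← hdim] at h2
  omega

/-- Modules with a filtration whose terms are zero or full on `J` are related on `J` to the
associated graded module. -/
theorem ThetaFiltration.equivOn_gr {J : Set V} {θ : V → ℚ} {M : PreprojRep m}
    (F : ThetaFiltration θ M) (hJ : ∃ j ∈ J, M.dim j ≠ 0)
    (hF : ∀ N : Sub M, pairing θ N.dim = 0 →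
      (∀ j ∈ J, N.carrier j = ⊥) ∨ ∀ j ∈ J, N.carrier j = ⊤) : EquivOn J M F.gr := by
  have hlast : ¬ ∀ j ∈ J, (F.F (Fin.last F.n)).carrier j = ⊥ := by
    intro h
    obtain ⟨j, hj, hd⟩ := hJ
    refine hd ?_
    rw [← (F.F (Fin.last F.n)).dim_of_eq_top (F.full j), Sub.dim_of_eq_bot _ (h j hj)]
  -- The step at which the filtration stops vanishing on `J`. There it becomes full on `J`, so every
  -- other layer is zero on `J`.
  have hex : ∃ k : Fin F.n, (∀ j ∈ J, (F.F k.castSucc).carrier j = ⊥) ∧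
      ¬ ∀ j ∈ J, (F.F k.succ).carrier j = ⊥ := by
    by_contra hcon
    push Not at hcon
    refine hlast (Fin.induction (motive := fun k => ∀ j ∈ J, (F.F k).carrier j = ⊥) ?_ ?_ _)
    · exact fun j _ => F.zero j
    · exact fun k hk => hcon k hk
  obtain ⟨k, hk0, hk1⟩ := hex
  have hk2 := (hF _ (F.pairing_eq_zero k.succ)).resolve_left hk1
  have hmono : ∀ j, Monotone fun l => (F.F l).carrier j := fun j =>
    Fin.monotone_iff_le_succ.2 fun l => F.mono l j
  refine (EquivOn.subquotient _ _ hk0 hk2).trans (EquivOn.bigSum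
    (fun l : Fin F.n => Sub.subquotient (F.F l.castSucc) (F.F l.succ)) k fun l hl j hj => ?_).symm
  have hd := Sub.subquotient_dim (F.mono l) j
  rcases lt_or_gt_of_ne hl with h | h
  · have h1 : (F.F l.succ).carrier j = ⊥ := by
      refine le_bot_iff.1 ((hmono j ?_).trans (hk0 j hj).le)
      exact Fin.succ_le_castSucc_iff.2 h
    rw [Sub.dim_of_eq_bot _ h1] at hd
    omega
  · have h1 : (F.F l.castSucc).carrier j = ⊤ := by
      refine top_le_iff.1 ((hk2 j hj).symm.le.trans (hmono j ?_))
      exact Fin.succ_le_castSucc_iff.2 h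
    have h2 := (F.F l.succ).dim_le j
    rw [Sub.dim_of_eq_top _ h1] at hd
    omega

theorem SEquiv.equivOn {J : Set V} {θ : V → ℚ} {M N : PreprojRep m} (h : SEquiv θ M N)
    (hMJ : ∃ j ∈ J, M.dim j ≠ 0)
    (hM : ∀ P : Sub M, pairing θ P.dim = 0 →
      (∀ j ∈ J, P.carrier j = ⊥) ∨ ∀ j ∈ J, P.carrier j = ⊤)
    (hNJ : ∃ j ∈ J, N.dim j ≠ 0)
    (hN : ∀ P : Sub N, pairing θ P.dim = 0 →
      (∀ j ∈ J, P.carrier j = ⊥) ∨ ∀ j ∈ J, P.carrier j = ⊤) : EquivOn J M N := by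
  obtain ⟨F, G, e⟩ := h
  exact (F.equivOn_gr hMJ hM).trans ((EquivOn.of_iso e).trans (G.equivOn_gr hNJ hN).symm)

end PreprojRep
end McKayNQV

namespace McKayNQV

/-! ### Traces of endomorphisms of finite order -/

section FiniteOrder

open Module Module.End

variable {E : Type*} [AddCommGroup E] [Module ℂ E] {f : Module.End ℂ E} {n : ℕ}

theorem norm_eq_one_of_eigenspace_ne_bot (hn : n ≠ 0) (hf : f ^ n = 1) {μ : ℂ}
    (h : f.eigenspace μ ≠ ⊥) : ‖μ‖ = 1 := by
  obtain ⟨x, hx, hx0⟩ := (Submodule.ne_bot_iff _).1 h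
  have hpow : ∀ k : ℕ, (f ^ k) x = μ ^ k • x := by
    intro k
    induction k with
    | zero => simp
    | succ k ih =>
      rw [pow_succ', Module.End.mul_apply, ih, map_smul, mem_eigenspace_iff.1 hx, smul_smul,
        pow_succ]
  have h1 := hpow n
  rw [hf, Module.End.one_apply] at h1
  have h2 : (μ ^ n - 1) • x = 0 := by rw [sub_smul, ← h1, one_smul, sub_self]
  have h3 : μ ^ n = 1 := sub_eq_zero.1 ((smul_eq_zero.1 h2).resolve_right hx0)
  exact Complex.norm_eq_one_of_pow_eq_one h3 hn

variable [FiniteDimensional ℂ E]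

/-- `X ^ n - 1` is separable in characteristic zero, so `f` is diagonalizable. -/
theorem iSup_eigenspace_eq_top_of_pow_eq_one (hn : n ≠ 0) (hf : f ^ n = 1) :
    ⨆ μ : ℂ, f.eigenspace μ = ⊤ := by
  have hsq : Squarefree (Polynomial.X ^ n - 1 : Polynomial ℂ) :=
    (Polynomial.X_pow_sub_one_separable_iff.2 (by exact_mod_cast hn)).squarefree
  have hss : f.IsSemisimple := isSemisimple_of_squarefree_aeval_eq_zero hsq (by simp [hf])
  rw [← hss.iSup_maxGenEigenspace_eq_top_iff]
  exact iSup_maxGenEigenspace_eq_top f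

theorem isInternal_eigenspace_of_pow_eq_one (hn : n ≠ 0) (hf : f ^ n = 1) :
    DirectSum.IsInternal fun μ : ℂ => f.eigenspace μ :=
  (DirectSum.isInternal_submodule_iff_iSupIndep_and_iSup_eq_top _).2
    ⟨f.eigenspaces_iSupIndep, iSup_eigenspace_eq_top_of_pow_eq_one hn hf⟩

/-- The eigenvalue expansion of the traces of an endomorphism of finite order and its inverse. -/
theorem exists_trace_eq_sum (hn : n ≠ 0) (hf : f ^ n = 1) {g : Module.End ℂ E} (hg : g * f = 1) :
    ∃ s : Finset ℂ, (∀ μ, μ ∈ s ↔ f.eigenspace μ ≠ ⊥) ∧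
      LinearMap.trace ℂ E f = ∑ μ ∈ s, μ * finrank ℂ (f.eigenspace μ) ∧
      LinearMap.trace ℂ E g = ∑ μ ∈ s, μ⁻¹ * finrank ℂ (f.eigenspace μ) ∧
      (finrank ℂ E : ℂ) = ∑ μ ∈ s, (finrank ℂ (f.eigenspace μ) : ℂ) := by
  have hI := isInternal_eigenspace_of_pow_eq_one hn hf
  have hfin : {μ : ℂ | f.eigenspace μ ≠ ⊥}.Finite :=
    WellFoundedGT.finite_ne_bot_of_iSupIndep f.eigenspaces_iSupIndep
  have key : ∀ (h : Module.End ℂ E) (c : ℂ → ℂ),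
      (∀ μ, ∀ x ∈ f.eigenspace μ, h x = c μ • x) →
      LinearMap.trace ℂ E h = ∑ μ ∈ hfin.toFinset, c μ * finrank ℂ (f.eigenspace μ) := by
    intro h c hc
    have hm : ∀ μ, Set.MapsTo h (f.eigenspace μ) (f.eigenspace μ) := fun μ x hx => by
      rw [hc μ x hx]
      exact Submodule.smul_mem _ _ hx
    rw [LinearMap.trace_eq_sum_trace_restrict' hI hfin hm]
    refine Finset.sum_congr rfl fun μ _ => ?_
    have : h.restrict (hm μ) = c μ • LinearMap.id := by
      ext x
      exact hc μ x.1 x.2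
    rw [this, map_smul, LinearMap.trace_id, smul_eq_mul]
  refine ⟨hfin.toFinset, fun μ => by simp, key f id fun μ x hx => mem_eigenspace_iff.1 hx, ?_, ?_⟩
  · refine key g (fun μ => μ⁻¹) fun μ x hx => ?_
    by_cases hx0 : x = 0
    · simp [hx0]
    have hμ : μ ≠ 0 := by
      rintro rfl
      have := norm_eq_one_of_eigenspace_ne_bot hn hf ((Submodule.ne_bot_iff _).2 ⟨x, hx, hx0⟩)
      simp at this
    have h1 : g (f x) = x := by rw [← Module.End.mul_apply, hg, Module.End.one_apply]
    rw [mem_eigenspace_iff.1 hx, map_smul] at h1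
    rw [eq_inv_smul_iff₀ hμ, h1]
  · have := key 1 1 fun μ x _ => by simp
    rw [LinearMap.trace_one] at this
    simpa using this

/-- The eigenvalues lie on the unit circle, where inversion is conjugation. -/
theorem trace_inv_eq_conj (hn : n ≠ 0) (hf : f ^ n = 1) {g : Module.End ℂ E} (hg : g * f = 1) :
    LinearMap.trace ℂ E g = starRingEnd ℂ (LinearMap.trace ℂ E f) := by
  obtain ⟨s, hs, h1, h2, -⟩ := exists_trace_eq_sum hn hf hg
  rw [h1, h2, map_sum]
  refine Finset.sum_congr rfl fun μ hμ => ?_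
  rw [map_mul, Complex.conj_natCast,
    Complex.inv_eq_conj (norm_eq_one_of_eigenspace_ne_bot hn hf ((hs μ).1 hμ))]

/-- The trace is a sum of `dim E` numbers of modulus one. If its real part reached `dim E`, all
eigenvalues would be `1`, and a diagonalizable `f` would be the identity. -/
theorem trace_re_lt (hn : n ≠ 0) (hf : f ^ n = 1) (h1 : f ≠ 1) :
    (LinearMap.trace ℂ E f).re < finrank ℂ E := by
  have hg : f ^ (n - 1) * f = 1 := by
    rw [← pow_succ, Nat.sub_add_cancel (Nat.one_le_iff_ne_zero.2 hn), hf]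
  obtain ⟨s, hs, ht, -, hd⟩ := exists_trace_eq_sum hn hf hg
  have hd' : (finrank ℂ E : ℝ) = ∑ μ ∈ s, (finrank ℂ (f.eigenspace μ) : ℝ) := by
    exact_mod_cast hd
  have ht' : (LinearMap.trace ℂ E f).re = ∑ μ ∈ s, μ.re * finrank ℂ (f.eigenspace μ) := by
    rw [ht, Complex.re_sum]
    exact Finset.sum_congr rfl fun μ _ => by simp
  rw [hd', ht']
  have hre : ∀ μ ∈ s, μ.re ≤ 1 := fun μ hμ =>
    (Complex.re_le_norm μ).trans (norm_eq_one_of_eigenspace_ne_bot hn hf ((hs μ).1 hμ)).le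
  refine Finset.sum_lt_sum (fun μ hμ => ?_) ?_
  · exact mul_le_of_le_one_left (Nat.cast_nonneg _) (hre μ hμ)
  · by_contra hcon
    push Not at hcon
    have hone : ∀ μ ∈ s, μ = 1 := by
      intro μ hμ
      have hpos : (0 : ℝ) < finrank ℂ (f.eigenspace μ) := by
        have := Submodule.finrank_eq_zero.not.2 ((hs μ).1 hμ)
        exact_mod_cast Nat.pos_of_ne_zero this
      have h2 : 1 ≤ μ.re := by
        have := hcon μ hμ
        nlinarith
      have h3 := norm_eq_one_of_eigenspace_ne_bot hn hf ((hs μ).1 hμ)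
      have h4 : μ.re = 1 := le_antisymm (hre μ hμ) h2
      have h5 : Complex.normSq μ = 1 := by rw [Complex.normSq_eq_norm_sq, h3, one_pow]
      rw [Complex.normSq_apply, h4] at h5
      refine Complex.ext h4 ?_
      simpa using h5
    refine h1 ?_
    have htop : f.eigenspace 1 = ⊤ := by
      rw [eq_top_iff, ← iSup_eigenspace_eq_top_of_pow_eq_one hn hf]
      refine iSup_le fun μ => ?_
      by_cases hμ : f.eigenspace μ = ⊥
      · rw [hμ]
        exact bot_le
      · rw [hone μ ((hs μ).2 hμ)]
    ext x
    have : x ∈ f.eigenspace 1 := htop ▸ Submodule.mem_top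
    simpa using mem_eigenspace_iff.1 this

end FiniteOrder

/-! ### Characters of finite groups and of the natural representation -/

theorem character_inv {G E : Type*} [Group G] [Finite G] [AddCommGroup E] [Module ℂ E]
    [FiniteDimensional ℂ E] (ρ : Representation ℂ G E) (g : G) :
    ρ.character g⁻¹ = starRingEnd ℂ (ρ.character g) := by
  refine trace_inv_eq_conj (n := Nat.card G) Nat.card_pos.ne' ?_ ?_
  · rw [← map_pow, pow_card_eq_one', map_one]
  · rw [← map_mul, inv_mul_cancel, map_one]

section NatRep

variable {Γ : Subgroup (Matrix.SpecialLinearGroup (Fin 2) ℂ)}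

theorem natRep_character (g : Γ) : (natRep Γ).character g = g.1.1.trace :=
  Matrix.trace_toLin'_eq _

/-- In `SL(2)` the inverse is the adjugate, which has the same trace: `ℂ²` is self-dual. -/
theorem natRep_character_inv (g : Γ) : (natRep Γ).character g⁻¹ = (natRep Γ).character g := by
  rw [natRep_character, natRep_character]
  have : (g⁻¹ : Γ).1.1 = g.1.1.adjugate := Matrix.SpecialLinearGroup.coe_inv g.1
  rw [this, Matrix.adjugate_fin_two, Matrix.trace_fin_two, Matrix.trace_fin_two]
  simp [add_comm]

/-- The natural representation is faithful, so `trace_re_lt` applies. -/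
theorem natRep_character_re_lt [Finite Γ] {g : Γ} (hg : g ≠ 1) :
    ((natRep Γ).character g).re < 2 := by
  have h : (natRep Γ g) ≠ 1 := by
    intro h
    apply hg
    have h' : Matrix.toLin' g.1.1 = Matrix.toLin' (1 : Matrix (Fin 2) (Fin 2) ℂ) := by
      rw [Matrix.toLin'_one]
      exact h
    exact Subtype.ext (Subtype.ext (Matrix.toLin'.injective h'))
  have h2 := trace_re_lt (n := Nat.card Γ) Nat.card_pos.ne'
    (by rw [← map_pow, pow_card_eq_one', map_one]) h
  simpa [Representation.character] using h2

theorem natRep_character_re_le [Finite Γ] (g : Γ) : ((natRep Γ).character g).re ≤ 2 := by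
  by_cases hg : g = 1
  · rw [hg, Representation.char_one]
    simp
  · exact (natRep_character_re_lt hg).le

end NatRep

/-! ### The Cartan form of the McKay graph -/

namespace IrrepList

variable {Γ : Subgroup (Matrix.SpecialLinearGroup (Fin 2) ℂ)} [Finite Γ] {r : ℕ}
  (L : IrrepList Γ r)

theorem mckay_eq_sum [Fintype Γ] (i j : Fin (r + 1)) :
    (Nat.card Γ : ℂ) * L.mckay i j = ∑ g : Γ, (L.ρ i).character g * (natRep Γ).character g *
      (L.ρ j).character g⁻¹ := by
  have hc : (Nat.card Γ : ℂ) ≠ 0 := by exact_mod_cast Nat.card_pos.ne'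
  let _ : Invertible (Nat.card Γ : ℂ) := invertibleOfNonzero hc
  rw [mckay, ← Representation.card_inv_mul_sum_char_mul_char_eq_finrank, ← mul_assoc,
    mul_inv_cancel₀ hc, one_mul]
  simp

/-- Substitute `g ↦ g⁻¹` in the character sum and use self-duality of `ℂ²`. -/
theorem mckay_comm (i j : Fin (r + 1)) : L.mckay i j = L.mckay j i := by
  have := Fintype.ofFinite Γ
  have hc : (Nat.card Γ : ℂ) ≠ 0 := by exact_mod_cast Nat.card_pos.ne'
  have : (Nat.card Γ : ℂ) * L.mckay i j = (Nat.card Γ : ℂ) * L.mckay j i := by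
    rw [mckay_eq_sum, mckay_eq_sum, ← Equiv.sum_comp (Equiv.inv Γ)]
    refine Finset.sum_congr rfl fun g _ => ?_
    simp only [Equiv.inv_apply, inv_inv, natRep_character_inv]
    ring
  exact_mod_cast mul_left_cancel₀ hc this

theorem sum_character_mul [Fintype Γ] (i j : Fin (r + 1)) :
    ∑ g : Γ, (L.ρ i).character g * (L.ρ j).character g⁻¹ =
      if i = j then (Nat.card Γ : ℂ) else 0 := by
  have hc : (Nat.card Γ : ℂ) ≠ 0 := by exact_mod_cast Nat.card_pos.ne'
  let _ : Invertible (Nat.card Γ : ℂ) := invertibleOfNonzero hc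
  have := L.irreducible i
  have := L.irreducible j
  have h := Representation.char_orthonormal (L.ρ i) (L.ρ j)
  have hij : Nonempty ((L.ρ j).Equiv (L.ρ i)) ↔ i = j := by
    constructor
    · intro h
      exact (L.distinct j i h).symm
    · rintro rfl
      exact ⟨.refl _⟩
  rw [inv_mul_eq_iff_eq_mul₀ hc] at h
  rw [h]
  by_cases h' : i = j
  · simp [hij.2 h', h']
  · have : ¬ Nonempty ((L.ρ j).Equiv (L.ρ i)) := fun h'' => h' (hij.1 h'')
    simp [this, h']

/-- The character of `⨁ i, ρ_i ^ (d i)`. -/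
noncomputable def sumCharacter (d : Fin (r + 1) → ℕ) (g : Γ) : ℂ :=
  ∑ i, (d i : ℂ) * (L.ρ i).character g

theorem sumCharacter_inv (d : Fin (r + 1) → ℕ) (g : Γ) :
    L.sumCharacter d g⁻¹ = starRingEnd ℂ (L.sumCharacter d g) := by
  simp [sumCharacter, character_inv]

theorem sum_sumCharacter_mul [Fintype Γ] (d : Fin (r + 1) → ℕ) (j : Fin (r + 1)) :
    ∑ g : Γ, L.sumCharacter d g * (L.ρ j).character g⁻¹ = Nat.card Γ * d j := by
  simp_rw [sumCharacter, Finset.sum_mul, mul_assoc]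
  rw [Finset.sum_comm]
  simp_rw [← Finset.mul_sum, sum_character_mul]
  simp [mul_comm]

/-- The Cartan form of the McKay graph in terms of characters. -/
theorem card_mul_cartan [Fintype Γ] (d : Fin (r + 1) → ℕ) :
    (Nat.card Γ : ℝ) * (∑ i, (d i : ℝ) * (2 * d i - ∑ j, (L.mckay i j : ℝ) * d j)) =
      ∑ g : Γ, Complex.normSq (L.sumCharacter d g) * (2 - ((natRep Γ).character g).re) := by
  -- `h1` and `h2` are the diagonal and the adjacency part of the form; twice the first minus the
  -- second is the claim over `ℂ`, and real parts finish.
  have h1 : ∑ g : Γ, L.sumCharacter d g * L.sumCharacter d g⁻¹ =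
      Nat.card Γ * ∑ i, (d i : ℂ) * d i := by
    have : ∀ g, L.sumCharacter d g * L.sumCharacter d g⁻¹ =
        ∑ j, (d j : ℂ) * (L.sumCharacter d g * (L.ρ j).character g⁻¹) := by
      intro g
      conv_lhs => rw [sumCharacter.eq_def L d g⁻¹, Finset.mul_sum]
      exact Finset.sum_congr rfl fun j _ => by ring
    simp_rw [this]
    rw [Finset.sum_comm, Finset.mul_sum]
    refine Finset.sum_congr rfl fun j _ => ?_
    rw [← Finset.mul_sum, sum_sumCharacter_mul]
    ring
  have h2 : ∑ g : Γ, L.sumCharacter d g * (natRep Γ).character g * L.sumCharacter d g⁻¹ =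
      Nat.card Γ * ∑ i, (d i : ℂ) * ∑ j, (L.mckay i j : ℂ) * d j := by
    have : ∀ g, L.sumCharacter d g * (natRep Γ).character g * L.sumCharacter d g⁻¹ =
        ∑ i, ∑ j, (d i : ℂ) * d j * ((L.ρ i).character g * (natRep Γ).character g *
          (L.ρ j).character g⁻¹) := by
      intro g
      simp only [sumCharacter]
      rw [Finset.sum_mul, Finset.sum_mul_sum]
      exact Finset.sum_congr rfl fun i _ => Finset.sum_congr rfl fun j _ => by ring
    simp_rw [this]
    rw [Finset.sum_comm, Finset.mul_sum]
    refine Finset.sum_congr rfl fun i _ => ?_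
    rw [Finset.sum_comm, Finset.mul_sum, Finset.mul_sum]
    refine Finset.sum_congr rfl fun j _ => ?_
    rw [← Finset.mul_sum, ← mckay_eq_sum]
    ring
  have h3 : ((Nat.card Γ : ℂ) * (∑ i, (d i : ℂ) * (2 * d i - ∑ j, (L.mckay i j : ℂ) * d j))) =
      ∑ g : Γ, (Complex.normSq (L.sumCharacter d g) : ℂ) * (2 - (natRep Γ).character g) := by
    calc _ = 2 * (Nat.card Γ * ∑ i, (d i : ℂ) * d i) -
          Nat.card Γ * ∑ i, (d i : ℂ) * ∑ j, (L.mckay i j : ℂ) * d j := by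
          rw [mul_left_comm, ← mul_sub, Finset.mul_sum _ _ (2 : ℂ), ← Finset.sum_sub_distrib]
          congr 1
          exact Finset.sum_congr rfl fun i _ => by ring
      _ = _ := by
          rw [← h1, ← h2, Finset.mul_sum, ← Finset.sum_sub_distrib]
          refine Finset.sum_congr rfl fun g _ => ?_
          rw [sumCharacter_inv, ← Complex.mul_conj]
          ring
  have h4 := congrArg Complex.re h3
  rw [Complex.re_sum] at h4
  have h5 : (Nat.card Γ : ℂ) * (∑ i, (d i : ℂ) * (2 * d i - ∑ j, (L.mckay i j : ℂ) * d j)) =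
      (((Nat.card Γ : ℝ) * (∑ i, (d i : ℝ) * (2 * d i - ∑ j, (L.mckay i j : ℝ) * d j)) : ℝ) : ℂ) :=
    by push_cast; rfl
  rw [h5, Complex.ofReal_re] at h4
  rw [h4]
  exact Finset.sum_congr rfl fun g _ => by rw [Complex.re_ofReal_mul]; simp

/-- The Cartan form of the McKay graph is positive on vectors that vanish at some vertex. -/
theorem eq_zero_of_cartan_nonpos (d : Fin (r + 1) → ℕ) (k : Fin (r + 1)) (hk : d k = 0)
    (h : ∀ i, d i ≠ 0 → 2 * d i ≤ ∑ j, L.mckay i j * d j) : d = 0 := by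
  have := Fintype.ofFinite Γ
  have hc : (Nat.card Γ : ℂ) ≠ 0 := by exact_mod_cast Nat.card_pos.ne'
  have hle : ∑ g : Γ, Complex.normSq (L.sumCharacter d g) * (2 - ((natRep Γ).character g).re) ≤
      0 := by
    rw [← card_mul_cartan]
    refine mul_nonpos_of_nonneg_of_nonpos (Nat.cast_nonneg _) (Finset.sum_nonpos fun i _ => ?_)
    by_cases hi : d i = 0
    · simp [hi]
    · refine mul_nonpos_of_nonneg_of_nonpos (Nat.cast_nonneg _) (sub_nonpos.2 ?_)
      exact_mod_cast h i hi
  have hnn : ∀ g ∈ (Finset.univ : Finset Γ),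
      0 ≤ Complex.normSq (L.sumCharacter d g) * (2 - ((natRep Γ).character g).re) := fun g _ =>
    mul_nonneg (Complex.normSq_nonneg _) (sub_nonneg.2 (natRep_character_re_le g))
  have hz := (Finset.sum_eq_zero_iff_of_nonneg hnn).1 (le_antisymm hle (Finset.sum_nonneg hnn))
  -- All summands are nonnegative with nonpositive sum, so each vanishes, and the second factor is
  -- positive off the identity.
  have hφ : ∀ g : Γ, g ≠ 1 → L.sumCharacter d g = 0 := fun g hg =>
    Complex.normSq_eq_zero.1 ((mul_eq_zero.1 (hz g (Finset.mem_univ g))).resolve_right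
      (sub_pos.2 (natRep_character_re_lt hg)).ne')
  -- The character is supported at `1`, so its pairing with `ρ_k` is `χ(1) dim ρ_k`. Since `d k =
  -- 0`, this forces `χ(1) = 0`; the character is then zero, and so are all multiplicities.
  have hk' := L.sum_sumCharacter_mul d k
  rw [hk, Nat.cast_zero, mul_zero, Finset.sum_eq_single 1 (fun g _ hg => by rw [hφ g hg, zero_mul])
    (by simp), inv_one, Representation.char_one] at hk'
  have := (Representation.irreducible_iff_isSimpleModule_asModule (L.ρ k)).1 (L.irreducible k)
  have : Nontrivial (L.ρ k).asModule := IsSimpleModule.nontrivial (MonoidAlgebra ℂ Γ) _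
  have hnt : Nontrivial (L.S k) := (L.ρ k).asModuleEquiv.symm.toEquiv.nontrivial
  have hdk : (Module.finrank ℂ (L.S k) : ℂ) ≠ 0 := by
    exact_mod_cast Module.finrank_pos.ne'
  have h1 := (mul_eq_zero.1 hk').resolve_right hdk
  funext i
  have hi := L.sum_sumCharacter_mul d i
  rw [Finset.sum_eq_zero fun g _ => ?_] at hi
  · exact_mod_cast (mul_eq_zero.1 hi.symm).resolve_left hc
  · by_cases hg : g = 1
    · rw [hg, h1, zero_mul]
    · rw [hφ g hg, zero_mul]

/-- The sum over the edges of the framed McKay graph at a vertex other than `∞`. -/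
theorem sum_framedEdges_le (w : Fin (r + 1) → ℕ) (d : Option (Fin (r + 1)) → ℕ)
    (i : Fin (r + 1)) :
    ∑ j, (L.framedEdges w (some i) j + L.framedEdges w j (some i)) * d j ≤
      w i * d none + ∑ j, L.mckay i j * d (some j) := by
  rw [Fintype.sum_option]
  refine add_le_add ?_ (Finset.sum_le_sum fun j _ => Nat.mul_le_mul_right _ ?_)
  · simp [framedEdges]
  · rcases lt_trichotomy i j with h | h | h
    · simp [framedEdges, h, h.not_gt, h.ne']
    · subst h
      -- The two copies of the truncated half of `mckay i i` add up to at most `mckay i i`; only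
      -- this inequality is needed.
      simp only [framedEdges, lt_irrefl, if_false, if_true]
      omega
    · simp [framedEdges, h, h.not_gt, h.ne', L.mckay_comm i j]

/-- The vertices in `I`, and `∞`. -/
def frameSet (I : Finset (Fin (r + 1))) : Set (Option (Fin (r + 1))) :=
  {j | ∀ i, j = some i → i ∈ I}

/-- Nonemptiness of `I` supplies the vertex at which `d` vanishes; vanishing at `∞` removes the
framing term. -/
theorem posOff_framedEdges {I : Finset (Fin (r + 1))} (hI : I.Nonempty) (w : Fin (r + 1) → ℕ) :
    PosOff (L.framedEdges w) (frameSet I) := by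
  intro d hd h
  obtain ⟨k, hk⟩ := hI
  have hnone : d none = 0 := hd none (by simp [frameSet])
  have := L.eq_zero_of_cartan_nonpos (fun i => d (some i)) k (hd (some k) (by simp [frameSet, hk]))
    fun i hi => by simpa [hnone] using (h (some i) hi).trans (L.sum_framedEdges_le w d i)
  funext i
  cases i with
  | none => exact hnone
  | some i => exact congrFun this i

end IrrepList

end McKayNQV

namespace McKayNQV
namespace IrrepList

variable {Γ : Subgroup (Matrix.SpecialLinearGroup (Fin 2) ℂ)} {r : ℕ} {L : IrrepList Γ r}
  {I : Finset (Fin (r + 1))} {v v' w : Fin (r + 1) → ℕ}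

/-! ### The stability parameter `θ_I` -/

theorem none_mem_frameSet : none ∈ frameSet I := by simp [frameSet]

theorem some_mem_frameSet {i : Fin (r + 1)} : some i ∈ frameSet I ↔ i ∈ I := by simp [frameSet]

theorem theta_eq_zero {i : Option (Fin (r + 1))} (hi : i ∉ frameSet I) : theta I v i = 0 := by
  cases i with
  | none => exact absurd none_mem_frameSet hi
  | some i =>
    rw [some_mem_frameSet] at hi
    simp [theta, hi]

theorem theta_congr (h : ∀ i ∈ I, v i = v' i) : theta I v = theta I v' := by
  funext i
  cases i with
  | none =>
    simp only [theta]
    rw [Finset.sum_congr rfl fun i hi => by rw [h i hi]]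
  | some i => rfl

theorem pairing_theta (d : Option (Fin (r + 1)) → ℕ) :
    pairing (theta I v) d = ∑ i ∈ I, (d (some i) : ℚ) - (∑ i ∈ I, (v i : ℚ)) * d none := by
  rw [pairing, Fintype.sum_option]
  simp only [theta, ite_mul, one_mul, zero_mul, Finset.sum_ite_mem, Finset.univ_inter]
  ring

/-- The dimension vector is `(1, v)` on `I` and `∞`. -/
def HasDimOn (I : Finset (Fin (r + 1))) (v : Fin (r + 1) → ℕ) (M : L.FramedModule w) : Prop :=
  M.dim none = 1 ∧ ∀ i ∈ I, M.dim (some i) = v i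

theorem SemistableModule.hasDimOn {θ : Option (Fin (r + 1)) → ℚ}
    (M : L.SemistableModule θ v w) : HasDimOn I v M.rep := by
  rw [HasDimOn, M.dim_eq]
  exact ⟨rfl, fun _ _ => rfl⟩

theorem HasDimOn.of_equivOn {M N : L.FramedModule w} (hM : HasDimOn I v M)
    (h : EquivOn (frameSet I) M N) : HasDimOn I v N :=
  ⟨(h.dim_eq none_mem_frameSet).symm.trans hM.1,
    fun i hi => (h.dim_eq (some_mem_frameSet.2 hi)).symm.trans (hM.2 i hi)⟩

theorem HasDimOn.pairing_eq_zero {M : L.FramedModule w} (hM : HasDimOn I v M) :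
    pairing (theta I v) M.dim = 0 := by
  rw [pairing_theta, hM.1, Nat.cast_one, mul_one, sub_eq_zero]
  exact Finset.sum_congr rfl fun i hi => by rw [hM.2 i hi]

theorem HasDimOn.sub_dim_none {M : L.FramedModule w} (hM : HasDimOn I v M) (P : Sub M) :
    P.dim none = 0 ∨ P.dim none = M.dim none := by
  have := P.dim_le none
  rw [hM.1] at this ⊢
  omega

/-- A submodule that is full at `∞`, and on which `θ_I` is nonnegative, is full on `I`. -/
theorem HasDimOn.eq_top {M : L.FramedModule w} (hM : HasDimOn I v M) (P : Sub M)
    (hP : P.dim none = M.dim none) (hpos : 0 ≤ pairing (theta I v) P.dim) :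
    ∀ j ∈ frameSet I, P.carrier j = ⊤ := by
  rw [pairing_theta, hP, hM.1, Nat.cast_one, mul_one, sub_nonneg] at hpos
  have hle : ∀ i ∈ I, P.dim (some i) ≤ v i := fun i hi => (hM.2 i hi) ▸ P.dim_le (some i)
  have heq : ∑ i ∈ I, P.dim (some i) = ∑ i ∈ I, v i :=
    le_antisymm (Finset.sum_le_sum hle) (by exact_mod_cast hpos)
  have h := (Finset.sum_eq_sum_iff_of_le hle).1 heq
  intro j hj
  cases j with
  | none => exact P.eq_top_of_dim_eq hP
  | some i =>
    rw [some_mem_frameSet] at hj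
    exact P.eq_top_of_dim_eq ((h i hj).trans (hM.2 i hj).symm)

theorem dim_eq_zero_of_pairing {d : Option (Fin (r + 1)) → ℕ}
    (hd : d none = 0) (h : pairing (theta I v) d = 0) : ∀ j ∈ frameSet I, d j = 0 := by
  rw [pairing_theta, hd, Nat.cast_zero, mul_zero, sub_zero] at h
  intro j hj
  cases j with
  | none => exact hd
  | some i =>
    rw [some_mem_frameSet] at hj
    have h' : ∑ i ∈ I, d (some i) = 0 := by exact_mod_cast h
    exact Finset.sum_eq_zero_iff.1 h' i hj

/-- If `P` vanishes at `∞`, then `θ_I` is the total dimension on `I`, which must be zero. If `P` is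
full at `∞`, then `θ_I` is minus the codimension on `I`. -/
theorem HasDimOn.bot_or_top {M : L.FramedModule w} (hM : HasDimOn I v M) (P : Sub M)
    (h : pairing (theta I v) P.dim = 0) :
    (∀ j ∈ frameSet I, P.carrier j = ⊥) ∨ ∀ j ∈ frameSet I, P.carrier j = ⊤ := by
  rcases hM.sub_dim_none P with h0 | h1
  · exact .inl fun j hj => (P.dim_eq_zero_iff j).1 (dim_eq_zero_of_pairing h0 h j hj)
  · exact .inr (hM.eq_top P h1 h.ge)

/-- Only submodules of `N` that are full at `∞` could violate semistability. Such a submodule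
transports to one of `M`, which semistability forces to be full on `I`, and fullness transports
back. -/
theorem isSemistable_of_equivOn {M N : L.FramedModule w} (hM : HasDimOn I v M)
    (hs : IsSemistable (theta I v) M) (h : EquivOn (frameSet I) M N) :
    IsSemistable (theta I v) N := by
  have hN := hM.of_equivOn h
  refine ⟨hN.pairing_eq_zero, fun P _ => ?_⟩
  rcases hN.sub_dim_none P with h0 | h1
  · rw [pairing_theta, h0, Nat.cast_zero, mul_zero, sub_zero]
    exact Finset.sum_nonneg fun i _ => Nat.cast_nonneg _
  · obtain ⟨P', hP'⟩ := h.exists_sub P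
    have hnone := (hP' none none_mem_frameSet).2 (P.eq_top_of_dim_eq h1)
    have hnone' := P'.dim_of_eq_top hnone
    have hnz : ¬ P'.IsZero := fun hz => by
      have h2 := P'.dim_of_eq_bot (hz none)
      rw [hnone', hM.1] at h2
      exact one_ne_zero h2
    have htop := hM.eq_top P' hnone' (hs.2 P' hnz)
    rw [← hN.pairing_eq_zero, pairing_theta, pairing_theta, h1]
    refine le_of_eq (congrArg₂ _ (Finset.sum_congr rfl fun i hi => ?_) rfl)
    have hi' := some_mem_frameSet.2 hi
    rw [P.dim_of_eq_top ((hP' _ hi').1 (htop _ hi'))]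

/-! ### Points of the quiver variety -/

theorem equivOn_of_sEquiv {M N : L.FramedModule w} (hM : HasDimOn I v M) (hN : HasDimOn I v N)
    (h : SEquiv (theta I v) M N) : EquivOn (frameSet I) M N :=
  h.equivOn ⟨none, none_mem_frameSet, by rw [hM.1]; exact one_ne_zero⟩ hM.bot_or_top
    ⟨none, none_mem_frameSet, by rw [hN.1]; exact one_ne_zero⟩ hN.bot_or_top

/-- Two semistable modules define the same point of the quiver variety if and only if they are
related on `I` and `∞`. -/
theorem mk_eq_mk_iff [Finite Γ] (hI : I.Nonempty) (M N : L.SemistableModule (theta I v) v w) :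
    NQVPoints.mk M = NQVPoints.mk N ↔ EquivOn (frameSet I) M.rep N.rep := by
  constructor
  · intro h
    -- Equality in the quotient is the equivalence relation generated by `SEquiv`, and `EquivOn` is
    -- itself an equivalence relation, so transitivity of `SEquiv` is not needed.
    replace h := Quot.eqvGen_exact h
    induction h with
    | rel M N h => exact equivOn_of_sEquiv M.hasDimOn N.hasDimOn h
    | refl M => exact .refl _
    | symm M N _ ih => exact ih.symm
    | trans M N P _ _ ih ih' => exact ih.trans ih'
  · intro h
    exact Quot.sound (h.sEquiv (L.posOff_framedEdges hI w) (fun i hi => theta_eq_zero hi)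
      M.hasDimOn.pairing_eq_zero (M.dim_eq.trans N.dim_eq.symm))

theorem simplesOff_dim_none (n : Fin (r + 1) → ℕ) :
    (L.simplesOff w I n).dim none = 0 :=
  vertexSimples_dim _ _

theorem simplesOff_dim_some (n : Fin (r + 1) → ℕ) (i : Fin (r + 1)) :
    (L.simplesOff w I n).dim (some i) = if i ∈ I then 0 else n i :=
  vertexSimples_dim _ _

theorem equivOn_directSum_simplesOff (C : L.FramedModule w) (n : Fin (r + 1) → ℕ) :
    EquivOn (frameSet I) (C.directSum (L.simplesOff w I n)) C := by
  refine EquivOn.directSum_left _ _ fun j hj => ?_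
  cases j with
  | none => exact simplesOff_dim_none n
  | some i => rw [simplesOff_dim_some, if_pos (some_mem_frameSet.1 hj)]

/-- Completing a module related to `M` on `I` and `∞` to dimension vector `(1, v')` by vertex
simples. -/
noncomputable def addSimples (M : L.SemistableModule (theta I v) v w) (C : L.FramedModule w)
    (h : EquivOn (frameSet I) M.rep C) (hv : ∀ i ∈ I, v i = v' i)
    (hle : ∀ i, C.dim (some i) ≤ v' i) : L.SemistableModule (theta I v') v' w where
  rep := C.directSum (L.simplesOff w I fun i => v' i - C.dim (some i))
  semistable := by
    rw [← theta_congr hv]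
    exact isSemistable_of_equivOn M.hasDimOn M.semistable
      (h.trans (equivOn_directSum_simplesOff C _).symm)
  dim_eq := by
    have hC := (M.hasDimOn (I := I)).of_equivOn h
    funext j
    rw [directSum_dim]
    cases j with
    | none => rw [simplesOff_dim_none, hC.1]; rfl
    | some i =>
      rw [simplesOff_dim_some]
      by_cases hi : i ∈ I
      · rw [if_pos hi, hC.2 i hi, hv i hi]; rfl
      · rw [if_neg hi]
        exact Nat.add_sub_cancel' (hle i)

theorem equivOn_addSimples (M : L.SemistableModule (theta I v) v w) (C : L.FramedModule w)
    (h : EquivOn (frameSet I) M.rep C) (hv : ∀ i ∈ I, v i = v' i)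
    (hle : ∀ i, C.dim (some i) ≤ v' i) :
    EquivOn (frameSet I) (addSimples M C h hv hle).rep M.rep :=
  (equivOn_directSum_simplesOff C _).trans h.symm

theorem SemistableModule.dim_some_le {θ : Option (Fin (r + 1)) → ℚ}
    (M : L.SemistableModule θ v w) (hle : ∀ i, v i ≤ v' i) (i : Fin (r + 1)) :
    M.rep.dim (some i) ≤ v' i := by
  rw [M.dim_eq]
  exact hle i

/-! ### The embedding of quiver varieties and its image -/

/-- Adding vertex simples to all points of the quiver variety. -/
noncomputable def embed [Finite Γ] (hI : I.Nonempty) (hv : ∀ i ∈ I, v i = v' i) (hle : ∀ i, v i ≤ v' i) :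
    L.NQVPoints (theta I v) v w → L.NQVPoints (theta I v') v' w :=
  Quot.lift (fun M => NQVPoints.mk (addSimples M M.rep (.refl _) hv (M.dim_some_le hle)))
    fun M N h => (mk_eq_mk_iff hI _ _).2 <| (equivOn_addSimples M _ _ _ _).trans <|
      (equivOn_of_sEquiv M.hasDimOn N.hasDimOn h).trans (equivOn_addSimples N _ _ _ _).symm

theorem embed_mk [Finite Γ] (hI : I.Nonempty) (hv : ∀ i ∈ I, v i = v' i) (hle : ∀ i, v i ≤ v' i)
    (M : L.SemistableModule (theta I v) v w) :
    embed hI hv hle (NQVPoints.mk M) =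
      NQVPoints.mk (addSimples M M.rep (.refl _) hv (M.dim_some_le hle)) := rfl

theorem embed_mk_eq_iff [Finite Γ] (hI : I.Nonempty) (hv : ∀ i ∈ I, v i = v' i)
    (hle : ∀ i, v i ≤ v' i) (M : L.SemistableModule (theta I v) v w)
    (N : L.SemistableModule (theta I v') v' w) :
    embed hI hv hle (NQVPoints.mk M) = NQVPoints.mk N ↔ EquivOn (frameSet I) M.rep N.rep := by
  rw [embed_mk, mk_eq_mk_iff hI]
  have h := equivOn_addSimples M M.rep (.refl _) hv (M.dim_some_le hle)
  exact ⟨h.symm.trans, h.trans⟩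

theorem embed_injective [Finite Γ] (hI : I.Nonempty) (hv : ∀ i ∈ I, v i = v' i)
    (hle : ∀ i, v i ≤ v' i) : Function.Injective (embed (L := L) (w := w) hI hv hle) := by
  rintro ⟨M⟩ ⟨N⟩ h
  refine (mk_eq_mk_iff hI M N).2 ?_
  exact ((embed_mk_eq_iff hI hv hle M _).1 h).trans (equivOn_addSimples N _ _ hv _)

/-- On a polystable module only the summand of dimension one at `∞` matters. -/
theorem equivOn_of_polystable {M : L.FramedModule w} (hM : HasDimOn I v M) {n : ℕ}
    {A : Fin n → L.FramedModule w} {a : Fin n} (hA : ∀ α, (A α).IsStable (theta I v))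
    (hiso : M.Iso (bigSum A)) (ha : (A a).dim none = 1) : EquivOn (frameSet I) M (A a) := by
  refine (EquivOn.of_iso hiso).trans (EquivOn.bigSum A a fun α hα => ?_)
  refine dim_eq_zero_of_pairing ?_ (hA α).2.1
  have h := hiso.dim_eq none
  -- The dimensions at `∞` add up to `1`, all of it used by `A a`; a stable summand vanishing at `∞`
  -- vanishes on `I` because `θ_I` does on it.
  rw [bigSum_dim, hM.1, ← Finset.add_sum_erase _ _ (Finset.mem_univ a), ha] at h
  have h0 : ∑ k ∈ Finset.univ.erase a, (A k).dim none = 0 := by omega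
  exact Finset.sum_eq_zero_iff.1 h0 α (Finset.mem_erase.2 ⟨hα, Finset.mem_univ α⟩)

/-- A module with no simple submodule or quotient at a vertex off `I` has dimension vector bounded
by any dimension vector that agrees on `I` and is sufficient. -/
theorem dim_le_of_injective_surjective [Finite Γ] (hI : I.Nonempty) {C : L.FramedModule w}
    (hC : HasDimOn I v C) (hinj : ∀ i ∉ frameSet I, C.OutInjective i ∧ C.InSurjective i)
    (hs : ∀ i ∉ I, ∑ j, L.mckay i j * v j ≤ 2 * v i) (hw : ∀ i ∉ I, w i = 0) (i : Fin (r + 1)) :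
    C.dim (some i) ≤ v i := by
  obtain ⟨k, hk⟩ := hI
  -- Truncated subtraction gives the positive part of `dim C - v`. Where it is nonzero, the bound
  -- for `C` and sufficiency of `v` subtract to the Cartan inequality; replacing the difference by
  -- its positive part at the neighbours only weakens it.
  have hz := L.eq_zero_of_cartan_nonpos (fun i => C.dim (some i) - v i) k
    (by simp [hC.2 k hk]) fun i hi => ?_
  · exact Nat.sub_eq_zero_iff_le.1 (congrFun hz i)
  · have hiI : i ∉ I := fun h => hi (by simp [hC.2 i h])
    obtain ⟨h1, h2⟩ := hinj (some i) fun h => hiI (some_mem_frameSet.1 h)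
    have h3 := (C.two_mul_dim_le (some i) h1 h2).trans (L.sum_framedEdges_le w C.dim i)
    rw [hw i hiI, zero_mul, zero_add] at h3
    have h4 : ∑ j, L.mckay i j * C.dim (some j) ≤
        ∑ j, L.mckay i j * v j + ∑ j, L.mckay i j * (C.dim (some j) - v j) := by
      rw [← Finset.sum_add_distrib]
      refine Finset.sum_le_sum fun j _ => ?_
      rw [← mul_add]
      exact Nat.mul_le_mul_left _ (by omega)
    have h5 := hs i hiI
    omega

/-- A module `C` of bounded dimension related to `N` is completed by simples to dimension `(1, v)`;
its image is again related to `N`, hence the same point. -/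
theorem embed_surjective [Finite Γ] (hI : I.Nonempty) (hv : ∀ i ∈ I, v i = v' i)
    (hle : ∀ i, v i ≤ v' i) (hs : ∀ i ∉ I, ∑ j, L.mckay i j * v j ≤ 2 * v i)
    (hw : ∀ i ∉ I, w i = 0) : Function.Surjective (embed (L := L) (w := w) hI hv hle) := by
  rintro ⟨N⟩
  obtain ⟨C, hC, hinj⟩ := exists_equivOn_injective_surjective (frameSet I) N.rep
  have hdim : HasDimOn I v C := by
    have := (N.hasDimOn (I := I)).of_equivOn hC
    exact ⟨this.1, fun i hi => (this.2 i hi).trans (hv i hi).symm⟩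
  -- `addSimples` is used here from `v'` to `v`: it asks only that the two vectors agree on `I` and
  -- that `v` bound the dimension of `C`.
  refine ⟨NQVPoints.mk (addSimples N C hC (fun i hi => (hv i hi).symm)
    (dim_le_of_injective_surjective hI hdim hinj hs hw)), ?_⟩
  exact (embed_mk_eq_iff hI hv hle _ N).2 (equivOn_addSimples N C hC _ _)

end IrrepList
end McKayNQV

theorem lemma5p10
    {Γ : Subgroup (Matrix.SpecialLinearGroup (Fin 2) ℂ)} [Finite Γ] {r : ℕ}
    (L : IrrepList Γ r) (I : Finset (Fin (r + 1))) (hI : I.Nonempty)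
    (U U' W : Fin (r + 1) → Type*)
    [∀ i, AddCommGroup (U i)] [∀ i, Module ℂ (U i)] [∀ i, FiniteDimensional ℂ (U i)]
    [∀ i, AddCommGroup (U' i)] [∀ i, Module ℂ (U' i)] [∀ i, FiniteDimensional ℂ (U' i)]
    [∀ i, AddCommGroup (W i)] [∀ i, Module ℂ (W i)] [∀ i, FiniteDimensional ℂ (W i)]
    (V : I → Type*)
    [∀ i, AddCommGroup (V i)] [∀ i, Module ℂ (V i)] [∀ i, FiniteDimensional ℂ (V i)]
    (hU : ∀ i : I, Nonempty (U i ≃ₗ[ℂ] V i)) (hU' : ∀ i : I, Nonempty (U' i ≃ₗ[ℂ] V i))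
    (hle : ∀ i, dimVec U i ≤ dimVec U' i) (hsuff : Sufficient L I U') :
    ∃ f : L.NQVPoints (theta I (dimVec U)) (dimVec U) (dimVec W) →
        L.NQVPoints (theta I (dimVec U')) (dimVec U') (dimVec W),
      -- `f` adds vertex simples to a semistable module
      (∀ M : L.SemistableModule (theta I (dimVec U)) (dimVec U) (dimVec W),
        ∃ N : L.SemistableModule (theta I (dimVec U')) (dimVec U') (dimVec W),
          N.rep.Iso (M.rep.directSum
            (L.simplesOff (dimVec W) I fun i => dimVec U' i - dimVec U i)) ∧
          f (NQVPoints.mk M) = NQVPoints.mk N) ∧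
      -- on a polystable module `⨁ α, A α`, with `A a` the summand of dimension one at `∞`
      (∀ (M : L.SemistableModule (theta I (dimVec U)) (dimVec U) (dimVec W))
        (n : ℕ) (A : Fin n → L.FramedModule (dimVec W)) (a : Fin n),
        (∀ α, (A α).IsStable (theta I (dimVec U))) → M.rep.Iso (bigSum A) →
        (A a).dim none = 1 →
        (∀ i, (A a).dim (some i) ≤ dimVec U' i) ∧
        ∃ N : L.SemistableModule (theta I (dimVec U')) (dimVec U') (dimVec W),
          N.rep.Iso ((A a).directSum
            (L.simplesOff (dimVec W) I fun i => dimVec U' i - (A a).dim (some i))) ∧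
          f (NQVPoints.mk M) = NQVPoints.mk N) ∧
      Function.Injective f ∧
      (Sufficient L I U → (∀ i, i ∉ I → Subsingleton (W i)) → Function.Bijective f) := by
  have hv : ∀ i ∈ I, dimVec U i = dimVec U' i := fun i hi => by
    obtain ⟨e⟩ := hU ⟨i, hi⟩
    obtain ⟨e'⟩ := hU' ⟨i, hi⟩
    exact (e.trans e'.symm).finrank_eq
  refine ⟨embed hI hv hle, fun M => ?_, fun M n A a hA hiso ha => ?_, embed_injective hI hv hle,
    fun hs hW => ⟨embed_injective hI hv hle, embed_surjective hI hv hle hs fun i hi => ?_⟩⟩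
  · refine ⟨_, Iso.of_eq ?_, embed_mk hI hv hle M⟩
    have : (fun i => dimVec U' i - M.rep.dim (some i)) = fun i => dimVec U' i - dimVec U i := by
      rw [M.dim_eq]
      rfl
    rw [← this]
    rfl
  · have h := equivOn_of_polystable M.hasDimOn hA hiso ha
    have hd : ∀ i, (A a).dim (some i) ≤ dimVec U' i := fun i => by
      -- The summand `A a` is no larger than `M`, whose dimension vector is bounded by that of `U'`.
      refine le_trans ?_ (M.dim_some_le hle i)
      rw [hiso.dim_eq, bigSum_dim]
      exact Finset.single_le_sum (f := fun k => (A k).dim (some i)) (fun _ _ => Nat.zero_le _)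
        (Finset.mem_univ a)
    exact ⟨hd, addSimples M (A a) h hv hd, Iso.refl _,
      (embed_mk_eq_iff hI hv hle M _).2 (equivOn_addSimples M (A a) h hv hd).symm⟩
  · have := hW i hi
    exact Module.finrank_zero_of_subsingleton
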